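/- **Model.** Let $\gamma>0$ and let $\nu$ be a probability law on $\mathbb R$, symmetric around $0$, with $\nu(|\xi|\ge t)=\frac1{1+t^\gamma}$ for all $t\ge 0$. Let $f_X$ be a probability density on $\mathbb R$, let $I=[a,b]$ with $a<b$, and let $K\subseteq I$ be a compact set such that $f_X$ is continuous and strictly positive at every point of $K$ (for instance $K=\{d_0\}$). For each $n$ let $m=m_n$ be an integer and consider $m$ parallel stump problems $$Y_{i,j}=\mathbf 1\{X_{i,j}>d_{0,i}\}+\xi_{i,j},\qquad 1\le i\le m,\ 1\le j\le n,$$ with change points $d_{0,i}=d_{0,i}^{(n)}\in K$, where all $mn$ pairs $(X_{i,j},\xi_{i,j})$ are independent, $X_{i,j}$ is independent of $\xi_{i,j}$, $X_{i,j}$ has density $f_X$ and $\xi_{i,j}$ has law $\nu$. Let $\hat d_i^{\ell_2}$ and $\hat d_i^{\ell_1}$ be the smallest minimizers over $d\in I$ of $\frac1n\sum_{j=1}^n (Y_{i,j}-\mathbf 1\{X_{i,j}>d\})^2$ and $\frac1n\sum_{j=1}^n |Y_{i,j}-\mathbf 1\{X_{i,j}>d\}|$ respectively. **Theorem.** (1)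 For every $t>0$ there is a constant $c(t)>0$, depending only on $t$ and on $(\gamma,\nu,f_X,I,K)$, such that whenever $n/m^{1/\gamma}\to\infty$, $$\liminf_{n\to\infty}\mathbb P\Big(\max_{1\le i\le m}\frac{n}{m^{1/\gamma}}\,\big|\hat d_i^{\ell_2}-d_{0,i}\big|>t\Big)\ \ge\ c(t).$$ (2) Let $c=\mu^2/(4b_0^2)$, where $\mu=\mathbb E\big[|\xi+1|-|\xi|\big]$ and $b_0$ is the range (essential supremum minus essential infimum) of $(|\xi+1|-|\xi|)-\mu$. If $n/\log m\to\infty$, then for every $t>0$ and all sufficiently large $n$, $$\mathbb P\Big(\frac{n}{\log m}\max_{1\le i\le m}\big|\hat d_i^{\ell_1}-d_{0,i}\big|>t\Big)\ \le\ \frac{2e^{-c}}{1-e^{-c}}\,\exp\Big\{-\log m\Big(t\,\frac{f_*}{2}\,(1-e^{-c})-1\Big)\Big\},\qquad f_*=\min_{1\le i\le m}f_X(d_{0,i}).$$ In particular $f_*=f_X(d_0)$ when all change points equal $d_0$. -/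

import Mathlib

open Filter Topology MeasureTheory ProbabilityTheory

noncomputable section

/-- The empirical criterion of the stump model, `d ↦ (1/n) ∑ⱼ φ (yⱼ - 1{xⱼ > d})`, for the loss
`φ` and the observations `(xⱼ, yⱼ)`, `j < n`. -/
def stumpCriterion (φ : ℝ → ℝ) {n : ℕ} (x y : Fin n → ℝ) (d : ℝ) : ℝ :=
  (1 / (n : ℝ)) * ∑ j, φ (y j - if d < x j then 1 else 0)

/-- The minimizers of the criterion over the parameter interval `[a, b]`. -/
def stumpArgmin (φ : ℝ → ℝ) (a b : ℝ) {n : ℕ} (x y : Fin n → ℝ) : Set ℝ :=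
  {d | d ∈ Set.Icc a b ∧ ∀ d' ∈ Set.Icc a b, stumpCriterion φ x y d ≤ stumpCriterion φ x y d'}

/-- The smallest argmin estimator of the change point over the interval `[a, b]`. -/
def changePointEstimator (φ : ℝ → ℝ) (a b : ℝ) {n : ℕ} (x y : Fin n → ℝ) : ℝ :=
  sInf (stumpArgmin φ a b x y)

/-- The estimator is a minimizer, and the smallest one. -/
theorem changePointEstimator_isLeast (φ : ℝ → ℝ) {a b : ℝ} (hab : a ≤ b) {n : ℕ}
    (x y : Fin n → ℝ) :
    IsLeast (stumpArgmin φ a b x y) (changePointEstimator φ a b x y) := by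
  classical
  let F : Finset ℝ := insert a ((Finset.univ.image x).filter fun u => u ∈ Set.Icc a b)
  have haF : a ∈ F := Finset.mem_insert_self _ _
  have hF : ∀ u ∈ F, u ∈ Set.Icc a b := by
    intro u hu
    rcases Finset.mem_insert.1 hu with rfl | hu
    · exact ⟨le_rfl, hab⟩
    · exact (Finset.mem_filter.1 hu).2
  have key : ∀ d ∈ Set.Icc a b, ∃ u ∈ F, u ≤ d ∧
      stumpCriterion φ x y u = stumpCriterion φ x y d := by
    intro d hd
    have hne : (F.filter fun u => u ≤ d).Nonempty := ⟨a, Finset.mem_filter.2 ⟨haF, hd.1⟩⟩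
    obtain ⟨huF, hud⟩ := Finset.mem_filter.1 (Finset.max'_mem _ hne)
    refine ⟨_, huF, hud, ?_⟩
    unfold stumpCriterion
    congr 1
    refine Finset.sum_congr rfl fun j _ => ?_
    have : (Finset.max' _ hne < x j) ↔ d < x j := by
      constructor
      · intro h
        by_contra hxd
        push Not at hxd
        have hax : a ≤ x j := ((hF _ huF).1.trans_lt h).le
        have hmem : x j ∈ F.filter fun u => u ≤ d := by
          refine Finset.mem_filter.2 ⟨Finset.mem_insert_of_mem (Finset.mem_filter.2
            ⟨Finset.mem_image_of_mem _ (Finset.mem_univ _), hax, hxd.trans hd.2⟩), hxd⟩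
        exact absurd (Finset.le_max' _ _ hmem) (not_le.2 h)
      · exact fun h => hud.trans_lt h
    simp only [this]
  obtain ⟨u₀, hu₀F, hu₀⟩ := F.exists_min_image (stumpCriterion φ x y) ⟨a, haF⟩
  have hmin : ∀ u ∈ F, (∀ v ∈ F, stumpCriterion φ x y u ≤ stumpCriterion φ x y v) →
      u ∈ stumpArgmin φ a b x y := by
    intro u hu h
    refine ⟨hF u hu, fun d hd => ?_⟩
    obtain ⟨v, hv, -, hvd⟩ := key d hd
    exact hvd ▸ h v hv
  let M : Finset ℝ := F.filter fun u => ∀ v ∈ F, stumpCriterion φ x y u ≤ stumpCriterion φ x y v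
  have hM : M.Nonempty := ⟨u₀, Finset.mem_filter.2 ⟨hu₀F, hu₀⟩⟩
  have hleast : IsLeast (stumpArgmin φ a b x y) (M.min' hM) := by
    obtain ⟨h1, h2⟩ := Finset.mem_filter.1 (M.min'_mem hM)
    refine ⟨hmin _ h1 h2, fun d hd => ?_⟩
    obtain ⟨v, hv, hvd, hve⟩ := key d hd.1
    refine (M.min'_le v (Finset.mem_filter.2 ⟨hv, fun w hw => ?_⟩)).trans hvd
    rw [hve]
    exact hd.2 w (hF w hw)
  have : changePointEstimator φ a b x y = M.min' hM := hleast.csInf_eq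
  rw [this]
  exact hleast

/-- `ν` is symmetric around `0` and satisfies `ν (|x| ≥ t) = 1 / (1 + t ^ γ)` for `t ≥ 0`. -/
structure IsSymmPowerTail (γ : ℝ) (ν : Measure ℝ) : Prop where
  symm : ν.map (fun x => -x) = ν
  tail : ∀ t : ℝ, 0 ≤ t → ν.real {x | t ≤ |x|} = 1 / (1 + t ^ γ)

/-- The random variables `X i j`, `ξ i j` (problem `i < m`, observation `j < n`) are the
covariates and the errors of `m` parallel problems: all pairs `(X i j, ξ i j)` are independent,
`X i j` is independent of `ξ i j`, `X i j` has density `f` and `ξ i j` has law `ν`. -/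
structure IsParallelDesign {Ω : Type*} [MeasurableSpace Ω] (P : Measure Ω) (f : ℝ → ℝ)
    (ν : Measure ℝ) {m n : ℕ} (X ξ : Fin m → Fin n → Ω → ℝ) : Prop where
  measurable_X : ∀ i j, Measurable (X i j)
  measurable_ξ : ∀ i j, Measurable (ξ i j)
  law_X : ∀ i j, P.map (X i j) = volume.withDensity fun x => ENNReal.ofReal (f x)
  law_ξ : ∀ i j, P.map (ξ i j) = ν
  indep_X_ξ : ∀ i j, IndepFun (X i j) (ξ i j) P
  indep : iIndepFun (fun (p : Fin m × Fin n) ω => (X p.1 p.2 ω, ξ p.1 p.2 ω)) P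

/-- The response `Y i j = 1{X i j > d₀ i} + ξ i j`. -/
def stumpResponse {Ω : Type*} {m n : ℕ} (d₀ : Fin m → ℝ) (X ξ : Fin m → Fin n → Ω → ℝ)
    (i : Fin m) (j : Fin n) (ω : Ω) : ℝ :=
  (if d₀ i < X i j ω then 1 else 0) + ξ i j ω

/-- The error `|d̂ᵢ - d₀ᵢ|` of the smallest argmin estimator over `[a, b]` with loss `φ` in the
`i`-th problem, computed from the `n` observations of that problem. -/
def changePointError (φ : ℝ → ℝ) (a b : ℝ) {Ω : Type*} {m n : ℕ} (d₀ : Fin m → ℝ)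
    (X ξ : Fin m → Fin n → Ω → ℝ) (i : Fin m) (ω : Ω) : ℝ :=
  |changePointEstimator φ a b (fun j => X i j ω) (fun j => stumpResponse d₀ X ξ i j ω) - d₀ i|

/-- `μ = E[|ξ + 1| - |ξ|]` for `ξ` with law `ν`. -/
def absStepMean (ν : Measure ℝ) : ℝ := ∫ x, (|x + 1| - |x|) ∂ν

/-- The range (essential supremum minus essential infimum) of `(|ξ + 1| - |ξ|) - μ`. -/
def absStepRange (ν : Measure ℝ) : ℝ :=
  essSup (fun x => |x + 1| - |x| - absStepMean ν) ν -
    essInf (fun x => |x + 1| - |x| - absStepMean ν) ν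

/-- The constant `μ² / (4 b²)` with `μ` and `b` the mean and the range above. -/
def absStepRate (ν : Measure ℝ) : ℝ := absStepMean ν ^ 2 / (4 * absStepRange ν ^ 2)

end

/-!
Both criteria, compared at two points, change only through the observations lying between them, so
the error of an estimator is governed by a random walk indexed by the distance from the change
point: its steps are `1 + 2 ξ` or `1 - 2 ξ` for least squares, and `|ξ + 1| - |ξ|` or
`|ξ - 1| - |ξ|` for least absolute deviations.

*Least squares.* Write `M = m ^ (1 / γ)` and `s = t M / n`. A window of width of order `s` around a
change point holds of order `M` observations. With probability bounded below, all their errors but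
one are at most of order `M ^ (1 / γ)`, so that the walk moves by at most order `M ^ (1 + 1 / γ)`.
One of these errors exceeds that level with probability of order
`M * M ^ (-(γ + 1)) = 1 / m`, and if its covariate sits between distance `s` and `2 s` of the change
point, then the minimizer is thrown out beyond distance `s`. This crude bound on the walk works for
every `γ > 0`, with or without moments (`exists_large_least_squares_error`, which rests on
`mul_half_le_measureReal_iUnion_oneBigJump`). As the `m` problems are independent, one of them has a
large error with probability at least `1 - exp (-κ)`. Since a change point may be an endpoint of
the interval, the jump is placed on whichever side has room.

*Least absolute deviations.* The steps lie in `[-1, 1]` and have positive mean `μ`, hence a walk of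
`k` steps is nonpositive with probability at most `exp (-k μ² / 2)` by Hoeffding's inequality. Given
the covariates, the index sets over which the walk is evaluated form a chain, so a union bound over
all points beyond distance `s` costs a geometric series started at the number of observations
within `s`; averaging over this binomial number gives the bound for one problem
(`measure_prod_exists_sum_nonpos_le`), and a union bound over the problems gives the rest. The
range of the steps is `2`, so the rate in the theorem is `c = μ² / 16` and the rate obtained is
`8 c`; the surplus absorbs the flat pieces on the left of the change point, where the smallest
minimizer escapes even along an empty walk (`inv_one_sub_exp_neg_eight_mul_le`).
-/

/-! ### The noise law -/

theorem IsSymmPowerTail.measureReal_Ici_eq_Iic_neg {γ : ℝ} {ν : Measure ℝ}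
    (hν : IsSymmPowerTail γ ν) (B : ℝ) : ν.real (Set.Ici B) = ν.real (Set.Iic (-B)) := by
  conv_lhs => rw [← hν.symm]
  rw [map_measureReal_apply measurable_neg measurableSet_Ici]
  congr 1
  ext x
  simp

theorem IsSymmPowerTail.measureReal_Iic_neg {γ : ℝ} {ν : Measure ℝ} [IsProbabilityMeasure ν]
    (hν : IsSymmPowerTail γ ν) {B : ℝ} (hB : 0 < B) :
    ν.real (Set.Iic (-B)) = 1 / (2 * (1 + B ^ γ)) := by
  have h1 := hν.tail B hB.le
  have h2 : {x : ℝ | B ≤ |x|} = Set.Iic (-B) ∪ Set.Ici B := by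
    ext x
    simp only [Set.mem_ofPred_eq, le_abs, Set.mem_union, Set.mem_Iic, Set.mem_Ici]
    constructor
    · rintro (h | h)
      · exact .inr h
      · exact .inl (by linarith)
    · rintro (h | h)
      · exact .inr (by linarith)
      · exact .inl h
  have hd : Disjoint (Set.Iic (-B)) (Set.Ici B) := by
    rw [Set.disjoint_left]
    intro x hx hx'
    simp only [Set.mem_Iic, Set.mem_Ici] at hx hx'
    linarith
  rw [h2, measureReal_union hd measurableSet_Ici, hν.measureReal_Ici_eq_Iic_neg B] at h1
  have : ν.real (Set.Iic (-B)) = (1 / (1 + B ^ γ)) / 2 := by linarith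
  rw [this]
  rw [div_div]
  ring

theorem IsSymmPowerTail.measureReal_Ici {γ : ℝ} {ν : Measure ℝ} [IsProbabilityMeasure ν]
    (hν : IsSymmPowerTail γ ν) {B : ℝ} (hB : 0 < B) :
    ν.real (Set.Ici B) = 1 / (2 * (1 + B ^ γ)) := by
  rw [hν.measureReal_Ici_eq_Iic_neg, hν.measureReal_Iic_neg hB]

theorem IsSymmPowerTail.measureReal_lt_abs_le {γ : ℝ} {ν : Measure ℝ} [IsProbabilityMeasure ν]
    (hν : IsSymmPowerTail γ ν) {R : ℝ} (hR : 0 ≤ R) :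
    ν.real {x | R < |x|} ≤ 1 / (1 + R ^ γ) := by
  rw [← hν.tail R hR]
  exact measureReal_mono fun x (hx : R < |x|) => hx.le

theorem abs_abs_add_one_sub_abs_le (x : ℝ) : |(|x + 1| - |x|)| ≤ 1 := by
  simpa using abs_abs_sub_abs_le_abs_sub (x + 1) x

theorem integrable_abs_add_one_sub_abs (ν : Measure ℝ) [IsProbabilityMeasure ν] :
    Integrable (fun x : ℝ => |x + 1| - |x|) ν := by
  refine Integrable.of_bound (by fun_prop) 1 (ae_of_all _ fun x => ?_)
  simpa using abs_abs_add_one_sub_abs_le x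

theorem absStepMean_le_one (ν : Measure ℝ) [IsProbabilityMeasure ν] : absStepMean ν ≤ 1 := by
  have := integral_mono (integrable_abs_add_one_sub_abs ν) (integrable_const (1 : ℝ))
    fun x => (abs_le.1 (abs_abs_add_one_sub_abs_le x)).2
  simpa [absStepMean] using this

theorem IsSymmPowerTail.absStepMean_eq_integral_neg {γ : ℝ} {ν : Measure ℝ}
    (hν : IsSymmPowerTail γ ν) : absStepMean ν = ∫ x, (|-x + 1| - |-x|) ∂ν := by
  unfold absStepMean
  conv_lhs => rw [← hν.symm]
  exact integral_map (by fun_prop) (by fun_prop)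

/-- By symmetry `2 μ = E[|ξ + 1| + |ξ - 1| - 2 |ξ|]`, whose integrand is the hat function
`2 (1 - |ξ|)⁺`. -/
theorem IsSymmPowerTail.absStepMean_pos {γ : ℝ} {ν : Measure ℝ} [IsProbabilityMeasure ν]
    (hν : IsSymmPowerTail γ ν) : 0 < absStepMean ν := by
  have hi := integrable_abs_add_one_sub_abs ν
  have hi' : Integrable (fun x : ℝ => |-x + 1| - |-x|) ν := by
    refine Integrable.of_bound (by fun_prop) 1 (ae_of_all _ fun x => ?_)
    simpa using abs_abs_add_one_sub_abs_le (-x)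
  have h2 : 2 * absStepMean ν = ∫ x, ((|x + 1| - |x|) + (|-x + 1| - |-x|)) ∂ν := by
    rw [integral_add hi hi', ← hν.absStepMean_eq_integral_neg, two_mul]
    rfl
  have hpt : ∀ x : ℝ, {x : ℝ | |x| < 1 / 2}.indicator (fun _ => (1 : ℝ)) x ≤
      (|x + 1| - |x|) + (|-x + 1| - |-x|) := by
    intro x
    rw [abs_neg]
    by_cases hx : |x| < 1 / 2
    · rw [Set.indicator_of_mem (by exact hx)]
      have := abs_lt.1 hx
      rw [abs_of_nonneg (by linarith : 0 ≤ x + 1), abs_of_nonneg (by linarith : 0 ≤ -x + 1)]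
      linarith
    · rw [Set.indicator_of_notMem (by exact hx)]
      have h1 := abs_add_le (x + 1) (-(-x + 1))
      have h3 : |x + 1 + -(-x + 1)| = 2 * |x| := by
        rw [show x + 1 + -(-x + 1) = 2 * x by ring, abs_mul, abs_two]
      rw [abs_neg] at h1
      linarith
  have hms : MeasurableSet {x : ℝ | |x| < 1 / 2} := measurableSet_lt (by fun_prop) (by fun_prop)
  have hle : ν.real {x : ℝ | |x| < 1 / 2} ≤ 2 * absStepMean ν := by
    rw [h2, ← integral_indicator_one hms]
    exact integral_mono ((integrable_const (1 : ℝ)).indicator hms) (hi.add hi') hpt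
  have hpos : 0 < ν.real {x : ℝ | |x| < 1 / 2} := by
    have hc : {x : ℝ | |x| < 1 / 2} = {x : ℝ | (1 / 2 : ℝ) ≤ |x|}ᶜ := by ext; simp
    rw [hc, probReal_compl_eq_one_sub (measurableSet_le (by fun_prop) (by fun_prop)),
      hν.tail _ (by norm_num)]
    have : (0 : ℝ) < (1 / 2) ^ γ := by positivity
    rw [sub_pos, div_lt_one (by positivity)]
    linarith
  linarith

theorem IsSymmPowerTail.absStepRange_eq {γ : ℝ} {ν : Measure ℝ} [IsProbabilityMeasure ν]
    (hν : IsSymmPowerTail γ ν) : absStepRange ν = 2 := by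
  have hpos : ∀ s : Set ℝ, (Set.Ici 1 ⊆ s ∨ Set.Iic (-1) ⊆ s) → ν s ≠ 0 := by
    intro s hs h0
    have h1 : ν.real s = 0 := by simp [measureReal_def, h0]
    have h2 : (0 : ℝ) < 1 / (2 * (1 + 1 ^ γ)) := by positivity
    rcases hs with hs | hs
    · have := measureReal_mono (μ := ν) hs
      rw [hν.measureReal_Ici one_pos] at this
      linarith
    · have := measureReal_mono (μ := ν) hs
      rw [hν.measureReal_Iic_neg one_pos] at this
      linarith
  set M := absStepMean ν
  have hsup : essSup (fun x => |x + 1| - |x| - M) ν = 1 - M := by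
    rw [essSup_eq_sInf]
    have : {c : ℝ | ν {x | c < |x + 1| - |x| - M} = 0} = Set.Ici (1 - M) := by
      ext c
      simp only [Set.mem_ofPred_eq, Set.mem_Ici]
      constructor
      · intro h
        by_contra! hc
        refine hpos _ (.inl fun x hx => ?_) h
        simp only [Set.mem_Ici, Set.mem_ofPred_eq] at hx ⊢
        rw [abs_of_nonneg (by linarith), abs_of_nonneg (by linarith)]
        linarith
      · intro h
        convert measure_empty (μ := ν)
        ext x
        have := (abs_le.1 (abs_abs_add_one_sub_abs_le x)).2
        simp only [Set.mem_ofPred_eq, Set.mem_empty_iff_false, iff_false, not_lt]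
        linarith
    rw [this, csInf_Ici]
  have hinf : essInf (fun x => |x + 1| - |x| - M) ν = -1 - M := by
    rw [essInf_eq_sSup]
    have : {c : ℝ | ν {x | |x + 1| - |x| - M < c} = 0} = Set.Iic (-1 - M) := by
      ext c
      simp only [Set.mem_ofPred_eq, Set.mem_Iic]
      constructor
      · intro h
        by_contra! hc
        refine hpos _ (.inr fun x hx => ?_) h
        simp only [Set.mem_Iic, Set.mem_ofPred_eq] at hx ⊢
        rw [abs_of_nonpos (by linarith), abs_of_nonpos (by linarith)]
        linarith
      · intro h
        convert measure_empty (μ := ν)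
        ext x
        have := (abs_le.1 (abs_abs_add_one_sub_abs_le x)).1
        simp only [Set.mem_ofPred_eq, Set.mem_empty_iff_false, iff_false, not_lt]
        linarith
    rw [this, csSup_Iic]
  rw [absStepRange, hsup, hinf]
  ring

theorem IsSymmPowerTail.absStepRate_eq {γ : ℝ} {ν : Measure ℝ} [IsProbabilityMeasure ν]
    (hν : IsSymmPowerTail γ ν) : absStepRate ν = absStepMean ν ^ 2 / 16 := by
  rw [absStepRate, hν.absStepRange_eq]
  norm_num

/-! ### The density near the change points -/

/-- On a uniform neighbourhood of the compact set of change points, the density stays within a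
factor `2` of its value at the change point. -/
theorem IsCompact.exists_half_le_le_two_mul {f : ℝ → ℝ} {K : Set ℝ} (hK : IsCompact K)
    (hf_cont : ∀ d ∈ K, ContinuousAt f d) (hf_pos : ∀ d ∈ K, 0 < f d) :
    ∃ δ > 0, ∀ d ∈ K, ∀ x, |x - d| ≤ δ → f d / 2 ≤ f x ∧ f x ≤ 2 * f d := by
  rcases K.eq_empty_or_nonempty with rfl | hne
  · exact ⟨1, one_pos, by simp⟩
  obtain ⟨d₁, hd₁, hmin⟩ := hK.exists_isMinOn hne
    (fun d hd => (hf_cont d hd).continuousWithinAt)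
  have hl := hf_pos d₁ hd₁
  have := hK.uniformContinuousAt_of_continuousAt f hf_cont
    (Metric.dist_mem_uniformity (half_pos hl))
  obtain ⟨δ, hδ, h⟩ := Metric.mem_uniformity_dist.1 this
  refine ⟨δ / 2, half_pos hδ, fun d hd x hx => ?_⟩
  have h1 : dist d x < δ := by
    rw [dist_comm, Real.dist_eq]
    linarith
  have h2 : dist (f d) (f x) < f d₁ / 2 := h h1 hd
  rw [Real.dist_eq, abs_lt] at h2
  have h3 : f d₁ ≤ f d := hmin hd
  constructor <;> linarith

theorem IsCompact.exists_pos_bounds {f : ℝ → ℝ} {K : Set ℝ} (hK : IsCompact K)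
    (hf_cont : ∀ d ∈ K, ContinuousAt f d) (hf_pos : ∀ d ∈ K, 0 < f d) :
    ∃ δ > 0, ∃ l > 0, ∃ u > 0, ∀ d ∈ K, ∀ x, |x - d| ≤ δ → l ≤ f x ∧ f x ≤ u := by
  rcases K.eq_empty_or_nonempty with rfl | hne
  · exact ⟨1, one_pos, 1, one_pos, 1, one_pos, by simp⟩
  have hc : ContinuousOn f K := fun d hd => (hf_cont d hd).continuousWithinAt
  obtain ⟨d₁, hd₁, hmin⟩ := hK.exists_isMinOn hne hc
  obtain ⟨d₂, hd₂, hmax⟩ := hK.exists_isMaxOn hne hc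
  obtain ⟨δ, hδ, h⟩ := hK.exists_half_le_le_two_mul hf_cont hf_pos
  refine ⟨δ, hδ, f d₁ / 2, half_pos (hf_pos _ hd₁), 2 * f d₂, by linarith [hf_pos _ hd₂],
    fun d hd x hx => ?_⟩
  have h1 : f d₁ ≤ f d := hmin hd
  have h2 : f d ≤ f d₂ := hmax hd
  have := h d hd x hx
  constructor <;> linarith

theorem le_measureReal_withDensity_Ioc {f : ℝ → ℝ} {l α β : ℝ}
    [IsFiniteMeasure (volume.withDensity fun x => ENNReal.ofReal (f x))] (hl : 0 ≤ l)
    (h : ∀ x ∈ Set.Ioc α β, l ≤ f x) :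
    l * (β - α) ≤ (volume.withDensity fun x => ENNReal.ofReal (f x)).real (Set.Ioc α β) := by
  rw [measureReal_def, ← ENNReal.ofReal_le_iff_le_toReal (measure_ne_top _ _),
    withDensity_apply _ measurableSet_Ioc, ENNReal.ofReal_mul hl, ← Real.volume_Ioc,
    ← setLIntegral_const]
  exact setLIntegral_mono' measurableSet_Ioc fun x hx => ENNReal.ofReal_le_ofReal (h x hx)

theorem measureReal_withDensity_Icc_le {f : ℝ → ℝ} {u α β : ℝ} (hαβ : α ≤ β) (hu : 0 ≤ u)
    (h : ∀ x ∈ Set.Icc α β, f x ≤ u) :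
    (volume.withDensity fun x => ENNReal.ofReal (f x)).real (Set.Icc α β) ≤ u * (β - α) := by
  rw [measureReal_def]
  refine ENNReal.toReal_le_of_le_ofReal (mul_nonneg hu (sub_nonneg.2 hαβ)) ?_
  rw [withDensity_apply _ measurableSet_Icc, ENNReal.ofReal_mul hu, ← Real.volume_Icc,
    ← setLIntegral_const]
  exact setLIntegral_mono' measurableSet_Icc fun x hx => ENNReal.ofReal_le_ofReal (h x hx)

/-! ### Comparing the criterion at two points -/

/-- Between `d` and `d'` only the observations in `(d, d']` change their residual. -/
theorem stumpCriterion_sub {φ : ℝ → ℝ} {n : ℕ} (hn : n ≠ 0) (x y : Fin n → ℝ) {d d' : ℝ}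
    (h : d ≤ d') :
    (n : ℝ) * (stumpCriterion φ x y d' - stumpCriterion φ x y d) =
      ∑ j with x j ∈ Set.Ioc d d', (φ (y j) - φ (y j - 1)) := by
  have hn' : (n : ℝ) ≠ 0 := by exact_mod_cast hn
  rw [stumpCriterion, stumpCriterion, ← mul_sub, ← mul_assoc, mul_one_div_cancel hn', one_mul,
    ← Finset.sum_sub_distrib, Finset.sum_filter]
  refine Finset.sum_congr rfl fun j _ => ?_
  simp only [Set.mem_Ioc]
  rcases lt_or_ge d (x j) with h1 | h1 <;> rcases lt_or_ge d' (x j) with h2 | h2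
  · simp [h1, h2, not_le.2 h2]
  · simp [h1, h2, not_lt.2 h2]
  · linarith
  · simp [not_lt.2 h1, not_lt.2 h2]

/-- A step function of the observations does not see a small move to the right, so the windows of
the random walk may be restricted to rational endpoints. -/
theorem exists_rat_gt_forall_le_iff {n : ℕ} (x : Fin n → ℝ) {d e : ℝ} (hde : d < e) :
    ∃ q : ℚ, d < q ∧ (q : ℝ) < e ∧ ∀ j, x j ≤ q ↔ x j ≤ d := by
  have h : ∀ᶠ u in 𝓝[>] d, ∀ j, x j ≤ u ↔ x j ≤ d := by
    refine eventually_all.2 fun j => ?_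
    rcases le_or_gt (x j) d with hj | hj
    · filter_upwards [self_mem_nhdsWithin] with u hu
      exact ⟨fun _ => hj, fun _ => hj.trans (Set.mem_Ioi.1 hu).le⟩
    · filter_upwards [Ioo_mem_nhdsGT hj] with u hu
      simp [not_le.2 hj, not_le.2 hu.2]
  obtain ⟨u, hu, hsub⟩ := (mem_nhdsGT_iff_exists_Ioo_subset' hde).1 (h.and (Ioo_mem_nhdsGT hde))
  obtain ⟨q, hq1, hq2⟩ := exists_rat_btwn (Set.mem_Ioi.1 hu)
  have := hsub ⟨hq1, hq2⟩
  exact ⟨q, hq1, this.2.2, this.1⟩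

/-! ### Least squares: one big jump -/

/-- A single term at most `1 - 2 B` outweighs the at most `N` others, each at most `1 + 2 R`. -/
theorem Finset.sum_neg_of_one_big_jump {ι : Type*} [DecidableEq ι] {A : Finset ι} {F : ι → ℝ}
    {j₀ : ι} {N R B : ℝ} (hR : 0 ≤ R) (hB : 1 + N * (1 + 2 * R) < 2 * B) (hj₀ : j₀ ∈ A)
    (hF₀ : F j₀ ≤ 1 - 2 * B) (hF : ∀ j ∈ A, j ≠ j₀ → F j ≤ 1 + 2 * R)
    (hcard : ((A.erase j₀).card : ℝ) ≤ N) : ∑ j ∈ A, F j < 0 := by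
  rw [← Finset.add_sum_erase A F hj₀]
  have h1 : ∑ j ∈ A.erase j₀, F j ≤ (A.erase j₀).card • (1 + 2 * R) :=
    Finset.sum_le_card_nsmul _ _ _ fun j hj =>
      hF j (Finset.mem_of_mem_erase hj) (Finset.ne_of_mem_erase hj)
  rw [nsmul_eq_mul] at h1
  have h2 : ((A.erase j₀).card : ℝ) * (1 + 2 * R) ≤ N * (1 + 2 * R) :=
    mul_le_mul_of_nonneg_right hcard (by linarith)
  linarith

/-- The observation `z j₀` lies in `J`, every other one avoids `G`, and at most `N` of the others
lie in `V`: in `V` there is one big jump and all else is tame. -/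
def oneBigJump {E : Type*} {n : ℕ} (J G V : Set E) (N : ℝ) (j₀ : Fin n) : Set (Fin n → E) :=
  {z | z j₀ ∈ J ∧ (∀ j ≠ j₀, z j ∉ G) ∧
    ∑ j ∈ Finset.univ.erase j₀, V.indicator (fun _ => (1 : ℝ)) (z j) ≤ N}

theorem measurableSet_oneBigJump {E : Type*} [MeasurableSpace E] {n : ℕ} {J G V : Set E}
    (hJ : MeasurableSet J) (hG : MeasurableSet G) (hV : MeasurableSet V) (N : ℝ) (j₀ : Fin n) :
    MeasurableSet (oneBigJump J G V N j₀) := by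
  have h1 : MeasurableSet {z : Fin n → E | z j₀ ∈ J} := measurable_pi_apply j₀ hJ
  have h2 : MeasurableSet {z : Fin n → E | ∀ j ≠ j₀, z j ∉ G} := by
    have : {z : Fin n → E | ∀ j ≠ j₀, z j ∉ G} =
        ⋂ j : Fin n, ⋂ _ : j ≠ j₀, (fun z : Fin n → E => z j) ⁻¹' Gᶜ := by
      ext z; simp
    rw [this]
    exact MeasurableSet.iInter fun j => MeasurableSet.iInter fun _ =>
      measurable_pi_apply j hG.compl
  have h3 : MeasurableSet {z : Fin n → E |
      ∑ j ∈ Finset.univ.erase j₀, V.indicator (fun _ => (1 : ℝ)) (z j) ≤ N} := by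
    refine measurableSet_le (Finset.measurable_sum _ fun j _ => ?_) measurable_const
    exact (measurable_const.indicator hV).comp (measurable_pi_apply j)
  exact h1.inter (h2.inter h3)

theorem measureReal_pi_eval_inter_eval {E : Type*} [MeasurableSpace E] (ρ : Measure E)
    [IsProbabilityMeasure ρ] {n : ℕ} {i j : Fin n} (hij : i ≠ j) {S T : Set E}
    (hS : MeasurableSet S) (hT : MeasurableSet T) :
    (Measure.pi fun _ : Fin n => ρ).real {z | z i ∈ S ∧ z j ∈ T} = ρ.real S * ρ.real T := by
  have hind : iIndepFun (fun (k : Fin n) (z : Fin n → E) => z k) (Measure.pi fun _ : Fin n => ρ) :=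
    iIndepFun_pi (X := fun _ e => e) fun _ => aemeasurable_id
  have h := (hind.indepFun hij).measure_inter_preimage_eq_mul S T hS hT
  have he : ∀ k, ∀ U : Set E, MeasurableSet U →
      (Measure.pi fun _ : Fin n => ρ) ((fun z => z k) ⁻¹' U) = ρ U := fun k U hU =>
    (measurePreserving_eval (fun _ : Fin n => ρ) k).measure_preimage hU.nullMeasurableSet
  rw [he i S hS, he j T hT] at h
  rw [measureReal_def, measureReal_def, measureReal_def, ← ENNReal.toReal_mul, ← h]
  rfl

theorem measureReal_pi_eval {E : Type*} [MeasurableSpace E] (ρ : Measure E)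
    [IsProbabilityMeasure ρ] {n : ℕ} (i : Fin n) {S : Set E} (hS : MeasurableSet S) :
    (Measure.pi fun _ : Fin n => ρ).real {z | z i ∈ S} = ρ.real S := by
  rw [measureReal_def, measureReal_def]
  congr 1
  exact (measurePreserving_eval (fun _ : Fin n => ρ) i).measure_preimage hS.nullMeasurableSet

/-- By pairwise independence and Markov's inequality, the tameness of the other observations
costs at most a factor `1 / 2`. -/
theorem half_le_measureReal_oneBigJump {E : Type*} [MeasurableSpace E] (ρ : Measure E)
    [IsProbabilityMeasure ρ] {n : ℕ} {J G V : Set E}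
    (hJ : MeasurableSet J) (hG : MeasurableSet G) (hV : MeasurableSet V) {N : ℝ} (hN : 0 < N)
    (hGn : n * ρ.real G ≤ 1 / 4) (hVn : n * ρ.real V ≤ N / 4) (j₀ : Fin n) :
    ρ.real J / 2 ≤ (Measure.pi fun _ : Fin n => ρ).real (oneBigJump J G V N j₀) := by
  set Q := Measure.pi fun _ : Fin n => ρ
  set Jj : Set (Fin n → E) := {z | z j₀ ∈ J}
  set bad : Set (Fin n → E) := ⋃ j ∈ Finset.univ.erase j₀, {z | z j₀ ∈ J ∧ z j ∈ G}
  set cnt : (Fin n → E) → ℝ := fun z =>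
    ∑ j ∈ Finset.univ.erase j₀, ({z | z j₀ ∈ J ∧ z j ∈ V} : Set (Fin n → E)).indicator 1 z
  set many : Set (Fin n → E) := {z | N ≤ cnt z}
  have hmeas : ∀ {T : Set E}, MeasurableSet T → ∀ j : Fin n,
      MeasurableSet {z : Fin n → E | z j₀ ∈ J ∧ z j ∈ T} := fun hT j =>
    (measurable_pi_apply j₀ hJ).inter (measurable_pi_apply j hT)
  have hsub : Jj ⊆ oneBigJump J G V N j₀ ∪ (bad ∪ many) := by
    intro z hz
    by_contra hcon
    simp only [Set.mem_union, not_or] at hcon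
    obtain ⟨h1, h2, h3⟩ := hcon
    refine h1 ⟨hz, fun j hj hjG => h2 ?_, ?_⟩
    · exact Set.mem_biUnion (Finset.mem_coe.2 (Finset.mem_erase.2 ⟨hj, Finset.mem_univ _⟩))
        (show z ∈ {z | z j₀ ∈ J ∧ z j ∈ G} from ⟨hz, hjG⟩)
    · have h4 : cnt z < N := not_le.1 h3
      refine le_trans (le_of_eq (Finset.sum_congr rfl fun j _ => ?_)) h4.le
      have hz' : z j₀ ∈ J := hz
      by_cases hj : z j ∈ V
      · simp [hj, hz']
      · simp [hj]
  have hcount : ∀ c : ℝ, ∀ T : Set E, MeasurableSet T → n * ρ.real T ≤ c →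
      ∑ j ∈ Finset.univ.erase j₀, Q.real {z | z j₀ ∈ J ∧ z j ∈ T} ≤ ρ.real J * c := by
    intro c T hT hc
    calc ∑ j ∈ Finset.univ.erase j₀, Q.real {z | z j₀ ∈ J ∧ z j ∈ T}
        = ∑ j ∈ Finset.univ.erase j₀, ρ.real J * ρ.real T :=
          Finset.sum_congr rfl fun j hj =>
            measureReal_pi_eval_inter_eval ρ (Finset.ne_of_mem_erase hj).symm hJ hT
      _ ≤ ∑ j : Fin n, ρ.real J * ρ.real T :=
          Finset.sum_le_sum_of_subset_of_nonneg (Finset.erase_subset _ _)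
            fun _ _ _ => by positivity
      _ = ρ.real J * (n * ρ.real T) := by
          rw [Finset.sum_const, Finset.card_univ, Fintype.card_fin, nsmul_eq_mul]
          ring
      _ ≤ ρ.real J * c := by gcongr
  have hbad : Q.real bad ≤ ρ.real J * (1 / 4) :=
    (measureReal_biUnion_finset_le _ _).trans (hcount _ G hG hGn)
  have hmany : Q.real many ≤ ρ.real J * (1 / 4) := by
    have hint : ∀ j ∈ Finset.univ.erase j₀, Integrable
        (({z | z j₀ ∈ J ∧ z j ∈ V} : Set (Fin n → E)).indicator (1 : (Fin n → E) → ℝ)) Q :=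
      fun j _ => (integrable_const (1 : ℝ)).indicator (hmeas hV j)
    have hM := mul_meas_ge_le_integral_of_nonneg (μ := Q) (f := cnt)
      (ae_of_all _ fun z => Finset.sum_nonneg fun j _ =>
        Set.indicator_nonneg (fun _ _ => zero_le_one) _) (integrable_finsetSum _ hint) N
    have hI : ∫ z, cnt z ∂Q ≤ ρ.real J * (N / 4) := by
      rw [integral_finsetSum _ hint]
      simp_rw [integral_indicator_one (hmeas hV _)]
      exact hcount _ V hV hVn
    have : N * Q.real many ≤ N * (ρ.real J * (1 / 4)) := by
      refine hM.trans (hI.trans (le_of_eq ?_))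
      ring
    exact le_of_mul_le_mul_left this hN
  have h1 : ρ.real J ≤ Q.real (oneBigJump J G V N j₀) + (Q.real bad + Q.real many) := by
    rw [← measureReal_pi_eval ρ j₀ hJ]
    exact (measureReal_mono hsub).trans ((measureReal_union_le _ _).trans
      (add_le_add_right (measureReal_union_le _ _) _))
  linarith

theorem mul_half_le_measureReal_iUnion_oneBigJump {E : Type*} [MeasurableSpace E] (ρ : Measure E)
    [IsProbabilityMeasure ρ] {n : ℕ} {J G V : Set E}
    (hJ : MeasurableSet J) (hG : MeasurableSet G) (hV : MeasurableSet V) (hJG : J ⊆ G)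
    {N : ℝ} (hN : 0 < N) (hGn : n * ρ.real G ≤ 1 / 4) (hVn : n * ρ.real V ≤ N / 4) :
    n * (ρ.real J / 2) ≤ (Measure.pi fun _ : Fin n => ρ).real (⋃ j₀, oneBigJump J G V N j₀) := by
  -- Since `J ⊆ G`, the jumping observation is unique and the events are disjoint.
  have hdisj : Pairwise (Function.onFun Disjoint fun j₀ : Fin n => oneBigJump J G V N j₀) := by
    intro j k hjk
    rw [Function.onFun, Set.disjoint_left]
    intro z hz hz'
    exact hz'.2.1 j hjk (hJG hz.1)
  rw [measureReal_iUnion_fintype hdisj fun j => measurableSet_oneBigJump hJ hG hV N j]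
  calc (n : ℝ) * (ρ.real J / 2) = ∑ _j : Fin n, ρ.real J / 2 := by simp
    _ ≤ _ := Finset.sum_le_sum fun j _ => half_le_measureReal_oneBigJump ρ hJ hG hV hN hGn hVn j

/-- Independent events of probability at least `κ / m`: one of the `m` occurs with probability at
least `1 - exp (-κ)`. -/
theorem one_sub_exp_neg_le_measureReal_pi_exists {E : Type*} [MeasurableSpace E] {m : ℕ}
    (hm : m ≠ 0) (Q : Measure E) [IsProbabilityMeasure Q] {F : Fin m → Set E}
    (hF : ∀ i, MeasurableSet (F i)) {κ : ℝ} (h : ∀ i, κ / m ≤ Q.real (F i)) :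
    1 - Real.exp (-κ) ≤ (Measure.pi fun _ : Fin m => Q).real {z | ∃ i, z i ∈ F i} := by
  have hm' : (m : ℝ) ≠ 0 := by exact_mod_cast hm
  have hc : {z : Fin m → E | ∃ i, z i ∈ F i} = (Set.univ.pi fun i => (F i)ᶜ)ᶜ := by
    ext z; simp [Set.mem_pi]
  rw [hc, probReal_compl_eq_one_sub (MeasurableSet.univ_pi fun i => (hF i).compl),
    measureReal_def, Measure.pi_pi, ENNReal.toReal_prod]
  have h1 : ∏ i : Fin m, (Q (F i)ᶜ).toReal ≤ ∏ _i : Fin m, Real.exp (-(κ / m)) := by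
    refine Finset.prod_le_prod (fun _ _ => ENNReal.toReal_nonneg) fun i _ => ?_
    rw [← measureReal_def, probReal_compl_eq_one_sub (hF i)]
    have := Real.add_one_le_exp (-(κ / m))
    linarith [h i]
  rw [Finset.prod_const, Finset.card_univ, Fintype.card_fin, ← Real.exp_nat_mul] at h1
  rw [show (m : ℝ) * -(κ / m) = -κ by field_simp] at h1
  linarith

/-- An observation in `(d₀ + s, d₀ + 2 s]` whose error is below `-B` makes the least squares
criterion at `d₀ + 2 s` smaller than anywhere within `s` of `d₀`. -/
theorem lt_abs_changePointEstimator_sub_of_jump_right {a b d₀ s N R B : ℝ} (hs : 0 < s)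
    (hab : a ≤ b) (had : a ≤ d₀) (hdb : d₀ + 2 * s ≤ b) (hR : 0 ≤ R)
    (hB : 1 + N * (1 + 2 * R) < 2 * B) {n : ℕ} {z : Fin n → ℝ × ℝ} {j₀ : Fin n}
    (hz : z ∈ oneBigJump (Set.Ioc (d₀ + s) (d₀ + 2 * s) ×ˢ Set.Iic (-B))
      (Set.Icc (d₀ - 2 * s) (d₀ + 2 * s) ×ˢ {u | R < |u|})
      (Set.Icc (d₀ - 2 * s) (d₀ + 2 * s) ×ˢ Set.univ) N j₀) :
    s < |changePointEstimator (fun u => u ^ 2) a b (fun j => (z j).1)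
      (fun j => (if d₀ < (z j).1 then 1 else 0) + (z j).2) - d₀| := by
  by_contra! hcon
  set x : Fin n → ℝ := fun j => (z j).1 with hx
  set y : Fin n → ℝ := fun j => (if d₀ < (z j).1 then 1 else 0) + (z j).2 with hy
  set e := changePointEstimator (fun u => u ^ 2) a b x y
  have he := abs_le.1 hcon
  have hn : n ≠ 0 := by rintro rfl; exact j₀.elim0
  obtain ⟨⟨hj1, hj2⟩, hbad, hcard⟩ := hz
  have hmin : stumpCriterion (fun u => u ^ 2) x y e ≤
      stumpCriterion (fun u => u ^ 2) x y (d₀ + 2 * s) :=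
    (changePointEstimator_isLeast (fun u => u ^ 2) hab x y).1.2 _ ⟨by linarith, hdb⟩
  have hsum := stumpCriterion_sub (φ := fun u => u ^ 2) hn x y
    (show e ≤ d₀ + 2 * s by linarith)
  have h0 : (0 : ℝ) ≤ n * (stumpCriterion (fun u => u ^ 2) x y (d₀ + 2 * s) -
      stumpCriterion (fun u => u ^ 2) x y e) := mul_nonneg n.cast_nonneg (sub_nonneg.2 hmin)
  rw [hsum] at h0
  refine absurd h0 (not_le.2 (Finset.sum_neg_of_one_big_jump (j₀ := j₀) (N := N) hR hB ?_ ?_ ?_ ?_))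
  · refine Finset.mem_filter.2 ⟨Finset.mem_univ _, lt_of_le_of_lt ?_ hj1.1, hj1.2⟩
    linarith
  · have h2 : (z j₀).2 ≤ -B := hj2
    have h3 : y j₀ = 1 + (z j₀).2 := by
      simp only [hy]
      rw [if_pos (by linarith [hj1.1])]
    simp only [h3]
    nlinarith
  · intro j hj hjj
    have hj' := (Finset.mem_filter.1 hj).2
    have h1 : (z j).1 ∈ Set.Icc (d₀ - 2 * s) (d₀ + 2 * s) :=
      ⟨by have : e < (z j).1 := hj'.1; linarith, hj'.2⟩
    have h2 : |(z j).2| ≤ R := by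
      by_contra! hR'
      exact hbad j hjj ⟨h1, hR'⟩
    have h3 : y j ≤ 1 + R := by
      have := (abs_le.1 h2).2
      simp only [hy]
      split_ifs <;> linarith
    nlinarith
  · refine le_trans ?_ hcard
    rw [Finset.card_eq_sum_ones, Nat.cast_sum, ← Finset.filter_erase, Finset.sum_filter]
    refine Finset.sum_le_sum fun j _ => ?_
    split_ifs with hj'
    · rw [Set.indicator_of_mem]
      · simp
      · exact ⟨⟨by have : e < (z j).1 := hj'.1; linarith, hj'.2⟩, trivial⟩
    · exact Set.indicator_nonneg (fun _ _ => zero_le_one) _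

/-- The mirror image of `lt_abs_changePointEstimator_sub_of_jump_right`, for change points with no
room on their right. -/
theorem lt_abs_changePointEstimator_sub_of_jump_left {a b d₀ s N R B : ℝ} (hs : 0 < s)
    (hab : a ≤ b) (had : a ≤ d₀ - 2 * s) (hdb : d₀ ≤ b) (hR : 0 ≤ R)
    (hB : 1 + N * (1 + 2 * R) < 2 * B) {n : ℕ} {z : Fin n → ℝ × ℝ} {j₀ : Fin n}
    (hz : z ∈ oneBigJump (Set.Ioc (d₀ - 2 * s) (d₀ - s) ×ˢ Set.Ici B)
      (Set.Icc (d₀ - 2 * s) (d₀ + 2 * s) ×ˢ {u | R < |u|})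
      (Set.Icc (d₀ - 2 * s) (d₀ + 2 * s) ×ˢ Set.univ) N j₀) :
    s < |changePointEstimator (fun u => u ^ 2) a b (fun j => (z j).1)
      (fun j => (if d₀ < (z j).1 then 1 else 0) + (z j).2) - d₀| := by
  by_contra! hcon
  set x : Fin n → ℝ := fun j => (z j).1 with hx
  set y : Fin n → ℝ := fun j => (if d₀ < (z j).1 then 1 else 0) + (z j).2 with hy
  set e := changePointEstimator (fun u => u ^ 2) a b x y
  have he := abs_le.1 hcon
  have hn : n ≠ 0 := by rintro rfl; exact j₀.elim0
  obtain ⟨⟨hj1, hj2⟩, hbad, hcard⟩ := hz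
  have hmin : stumpCriterion (fun u => u ^ 2) x y e ≤
      stumpCriterion (fun u => u ^ 2) x y (d₀ - 2 * s) :=
    (changePointEstimator_isLeast (fun u => u ^ 2) hab x y).1.2 _ ⟨had, by linarith⟩
  have hsum := stumpCriterion_sub (φ := fun u => u ^ 2) hn x y
    (show d₀ - 2 * s ≤ e by linarith)
  have h0 : 0 ≤ -((n : ℝ) * (stumpCriterion (fun u => u ^ 2) x y e -
      stumpCriterion (fun u => u ^ 2) x y (d₀ - 2 * s))) := by
    rw [← mul_neg, neg_sub]
    exact mul_nonneg n.cast_nonneg (sub_nonneg.2 hmin)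
  rw [hsum, ← Finset.sum_neg_distrib] at h0
  refine absurd h0 (not_le.2 (Finset.sum_neg_of_one_big_jump (j₀ := j₀) (N := N) hR hB ?_ ?_ ?_ ?_))
  · exact Finset.mem_filter.2 ⟨Finset.mem_univ _, hj1.1, hj1.2.trans (by linarith)⟩
  · have h2 : B ≤ (z j₀).2 := hj2
    have h3 : y j₀ = (z j₀).2 := by
      simp only [hy]
      rw [if_neg (by linarith [hj1.2]), zero_add]
    simp only [h3]
    nlinarith
  · intro j hj hjj
    have hj' := (Finset.mem_filter.1 hj).2
    have h1 : (z j).1 ∈ Set.Icc (d₀ - 2 * s) (d₀ + 2 * s) :=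
      ⟨hj'.1.le, by have : (z j).1 ≤ e := hj'.2; linarith⟩
    have h2 : |(z j).2| ≤ R := by
      by_contra! hR'
      exact hbad j hjj ⟨h1, hR'⟩
    have h3 : -R ≤ y j := by
      have := (abs_le.1 h2).1
      simp only [hy]
      split_ifs <;> linarith
    nlinarith
  · refine le_trans ?_ hcard
    rw [Finset.card_eq_sum_ones, Nat.cast_sum, ← Finset.filter_erase, Finset.sum_filter]
    refine Finset.sum_le_sum fun j _ => ?_
    split_ifs with hj'
    · rw [Set.indicator_of_mem]
      · simp
      · exact ⟨⟨hj'.1.le, by have : (z j).1 ≤ e := hj'.2; linarith⟩, trivial⟩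
    · exact Set.indicator_nonneg (fun _ _ => zero_le_one) _

/-- The one-big-jump bound for a window `W` of covariates, of expected number at most `N / 4`, with
the cutoff `R = N ^ (1 / γ)`, which the errors seen in `W` all respect with high probability. -/
theorem mul_half_measureReal_prod_le_iUnion_oneBigJump {γ : ℝ} (hγ : 0 < γ) {ν : Measure ℝ}
    [IsProbabilityMeasure ν] (hν : IsSymmPowerTail γ ν) (μX : Measure ℝ) [IsProbabilityMeasure μX]
    {n : ℕ} {W W' T : Set ℝ} (hW : MeasurableSet W) (hW' : MeasurableSet W')
    (hT : MeasurableSet T) (hWW : W' ⊆ W) {N R : ℝ} (hN : 0 < N) (hR : R = N ^ (1 / γ))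
    (hTR : T ⊆ {u | R < |u|}) (hnW : n * μX.real W ≤ N / 4) :
    n * (μX.real W' * ν.real T / 2) ≤ (Measure.pi fun _ : Fin n => μX.prod ν).real
      (⋃ j₀, oneBigJump (W' ×ˢ T) (W ×ˢ {u | R < |u|}) (W ×ˢ Set.univ) N j₀) := by
  have hR0 : 0 ≤ R := by rw [hR]; positivity
  have hRγ : R ^ γ = N := by
    rw [hR, ← Real.rpow_mul hN.le, one_div_mul_cancel hγ.ne', Real.rpow_one]
  have hms : MeasurableSet {u : ℝ | R < |u|} := measurableSet_lt (by fun_prop) (by fun_prop)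
  have h := mul_half_le_measureReal_iUnion_oneBigJump (μX.prod ν) (n := n) (hW'.prod hT)
    (hW.prod hms) (hW.prod MeasurableSet.univ) (Set.prod_mono hWW hTR) hN ?_ ?_
  · rwa [measureReal_prod_prod] at h
  · rw [measureReal_prod_prod, ← mul_assoc]
    have h1 := hν.measureReal_lt_abs_le hR0
    rw [hRγ] at h1
    calc n * μX.real W * ν.real {u | R < |u|} ≤ N / 4 * (1 / (1 + N)) := by gcongr
      _ ≤ 1 / 4 := by
        rw [mul_one_div, div_le_iff₀ (by positivity)]
        linarith
  · rwa [measureReal_prod_prod, probReal_univ, mul_one]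

/-- The size of the big jump, in units of `m ^ (1 / γ) * m ^ (1 / γ²)`. -/
noncomputable def jumpScale (γ u t : ℝ) : ℝ :=
  1 + (16 * t * u) ^ (1 / γ) + 16 * t * u * (1 + 2 * (16 * t * u) ^ (1 / γ))

/-- `m` times a lower bound on the probability that a single least squares problem has an error
above `t * m ^ (1 / γ) / n`, when the density lies between `l` and `u` near the change point. -/
noncomputable def jumpRate (γ l u t : ℝ) : ℝ := l * t / (4 * (1 + jumpScale γ u t ^ γ))

theorem jumpScale_pos {γ u t : ℝ} (hu : 0 < u) (ht : 0 < t) : 0 < jumpScale γ u t := by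
  unfold jumpScale; positivity

theorem jumpRate_pos {γ l u t : ℝ} (hl : 0 < l) (hu : 0 < u) (ht : 0 < t) :
    0 < jumpRate γ l u t := by
  have := jumpScale_pos (γ := γ) hu ht
  unfold jumpRate; positivity

/-- With `M = m ^ (1 / γ)` and about `M` observations in the window, all errors but one are at
most of order `M ^ (1 / γ)` and so contribute at most order `M ^ (1 + 1 / γ)`; one of these
`M` errors exceeds that with probability of order `M * M ^ (-(γ + 1)) = 1 / m`. -/
theorem exists_large_least_squares_error {γ : ℝ} (hγ : 0 < γ) {ν : Measure ℝ}
    [IsProbabilityMeasure ν] (hν : IsSymmPowerTail γ ν) {f : ℝ → ℝ}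
    [IsProbabilityMeasure (volume.withDensity fun x => ENNReal.ofReal (f x))]
    {a b d₀ l u s t : ℝ} {m n : ℕ} (hm : m ≠ 0) (hn : n ≠ 0) (hd₀ : d₀ ∈ Set.Icc a b)
    (hl : 0 < l) (hu : 0 < u) (ht : 0 < t) (hs : s = t * (m : ℝ) ^ (1 / γ) / n)
    (hsab : 4 * s ≤ b - a) (hf : ∀ x, |x - d₀| ≤ 2 * s → l ≤ f x ∧ f x ≤ u) :
    ∃ F : Set (Fin n → ℝ × ℝ), MeasurableSet F ∧
      jumpRate γ l u t / m ≤ (Measure.pi fun _ : Fin n =>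
        (volume.withDensity fun x => ENNReal.ofReal (f x)).prod ν).real F ∧
      ∀ z ∈ F, s < |changePointEstimator (fun v => v ^ 2) a b (fun j => (z j).1)
        (fun j => (if d₀ < (z j).1 then 1 else 0) + (z j).2) - d₀| := by
  set μX := volume.withDensity fun x => ENNReal.ofReal (f x)
  set M : ℝ := (m : ℝ) ^ (1 / γ) with hM
  set H : ℝ := M ^ (1 / γ) with hH
  set L : ℝ := (16 * t * u) ^ (1 / γ) with hL
  set C := jumpScale γ u t with hC
  set N : ℝ := 16 * t * u * M with hNdef
  set R : ℝ := N ^ (1 / γ) with hRdef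
  set B : ℝ := C * (M * H) with hBdef
  have hm1 : (1 : ℝ) ≤ m := by exact_mod_cast Nat.one_le_iff_ne_zero.2 hm
  have hn0 : (0 : ℝ) < n := by exact_mod_cast Nat.pos_of_ne_zero hn
  have hM1 : 1 ≤ M := Real.one_le_rpow hm1 (by positivity)
  have hH1 : 1 ≤ H := Real.one_le_rpow hM1 (by positivity)
  have hMH1 : 1 ≤ M * H := one_le_mul_of_one_le_of_one_le hM1 hH1
  have hM0 : 0 < M := by linarith
  have hL0 : 0 < L := by positivity
  have hC0 : 0 < C := jumpScale_pos hu ht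
  have hCeq : C = 1 + L + 16 * t * u * (1 + 2 * L) := rfl
  have hN0 : 0 < N := by positivity
  have hR0 : 0 ≤ R := by positivity
  have hB0 : 0 < B := by positivity
  have hs0 : 0 < s := by rw [hs]; positivity
  have hns : n * s = t * M := by rw [hs]; field_simp
  have hRL : R = L * H := Real.mul_rpow (by positivity) hM0.le
  have hMγ : M ^ γ = m := by
    rw [hM, ← Real.rpow_mul (by linarith), one_div_mul_cancel hγ.ne', Real.rpow_one]
  have hHγ : H ^ γ = M := by
    rw [hH, ← Real.rpow_mul hM0.le, one_div_mul_cancel hγ.ne', Real.rpow_one]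
  have hBγ : B ^ γ = C ^ γ * (m * M) := by
    rw [hBdef, Real.mul_rpow hC0.le (by positivity), Real.mul_rpow hM0.le (by positivity), hMγ,
      hHγ]
  have hRB : R < B := by
    have h1 : L * H ≤ L * (M * H) := by
      refine mul_le_mul_of_nonneg_left ?_ hL0.le
      nlinarith
    have h2 : 0 < 16 * t * u * (1 + 2 * L) * (M * H) := by positivity
    rw [hRL, hBdef, hCeq]
    nlinarith
  -- `jumpScale` is chosen so that `B` beats both the cutoff `R` and the crude bound
  -- `N * (1 + 2 * R)` on the displacement of the walk caused by all the other errors.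
  have hjump : 1 + N * (1 + 2 * R) < 2 * B := by
    have h1 : N * (1 + 2 * R) ≤ 16 * t * u * (1 + 2 * L) * (M * H) := by
      have h3 : 1 + 2 * R ≤ (1 + 2 * L) * H := by
        rw [hRL]; nlinarith
      calc N * (1 + 2 * R) ≤ N * ((1 + 2 * L) * H) := mul_le_mul_of_nonneg_left h3 hN0.le
        _ = _ := by rw [hNdef]; ring
    have h2 : 1 + 16 * t * u * (1 + 2 * L) * (M * H) ≤ B := by
      have h4 : 0 ≤ L * (M * H) := by positivity
      rw [hBdef, hCeq]
      nlinarith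
    linarith
  have hW : MeasurableSet (Set.Icc (d₀ - 2 * s) (d₀ + 2 * s)) := measurableSet_Icc
  have hnW : n * μX.real (Set.Icc (d₀ - 2 * s) (d₀ + 2 * s)) ≤ N / 4 := by
    have h1 := measureReal_withDensity_Icc_le (f := f) (u := u)
      (show d₀ - 2 * s ≤ d₀ + 2 * s by linarith) hu.le
      fun x hx => (hf x (abs_le.2 ⟨by linarith [hx.1], by linarith [hx.2]⟩)).2
    calc n * μX.real (Set.Icc (d₀ - 2 * s) (d₀ + 2 * s))
        ≤ n * (u * (d₀ + 2 * s - (d₀ - 2 * s))) := mul_le_mul_of_nonneg_left h1 hn0.le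
      _ = 4 * u * (n * s) := by ring
      _ = N / 4 := by rw [hns, hNdef]; ring
  have hfinal : ∀ W' : Set ℝ, l * s ≤ μX.real W' → jumpRate γ l u t / m ≤
      n * (μX.real W' * (1 / (2 * (1 + B ^ γ))) / 2) := by
    intro W' hW'
    have hmM : 1 ≤ m * M := one_le_mul_of_one_le_of_one_le hm1 hM1
    have hD : 1 + B ^ γ ≤ (1 + C ^ γ) * (m * M) := by
      rw [hBγ]; linarith
    have hCγ : 0 < C ^ γ := by positivity
    calc jumpRate γ l u t / m = l * (t * M) / (4 * ((1 + C ^ γ) * (m * M))) := by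
          rw [jumpRate, ← hC]; field_simp
      _ ≤ l * (t * M) / (4 * (1 + B ^ γ)) := by gcongr
      _ = n * ((l * s) * (1 / (2 * (1 + B ^ γ))) / 2) := by
          have hBγ0 : 0 < 1 + B ^ γ := by positivity
          rw [← hns]
          field_simp
          norm_num
      _ ≤ _ := by gcongr
  have hIci : Set.Ici B ⊆ {v : ℝ | R < |v|} := fun v hv =>
    lt_of_lt_of_le hRB ((Set.mem_Ici.1 hv).trans (le_abs_self v))
  have hIic : Set.Iic (-B) ⊆ {v : ℝ | R < |v|} := fun v hv =>
    lt_of_lt_of_le hRB ((le_neg.1 (Set.mem_Iic.1 hv)).trans (neg_le_abs v))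
  have hms : MeasurableSet {v : ℝ | R < |v|} := measurableSet_lt (by fun_prop) (by fun_prop)
  -- One of `d₀ + 2 s` and `d₀ - 2 s` lies in `[a, b]`, because `4 s ≤ b - a`.
  rcases le_total (d₀ + 2 * s) b with hside | hside
  · have hW' : l * s ≤ μX.real (Set.Ioc (d₀ + s) (d₀ + 2 * s)) := by
      refine le_trans (le_of_eq ?_) (le_measureReal_withDensity_Ioc (f := f) hl.le fun x hx =>
        (hf x (abs_le.2 ⟨by linarith [hx.1], by linarith [hx.2]⟩)).1)
      ring
    have hP := mul_half_measureReal_prod_le_iUnion_oneBigJump hγ hν μX (n := n) hW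
      (measurableSet_Ioc (a := d₀ + s) (b := d₀ + 2 * s)) (measurableSet_Iic (a := -B))
      (fun x hx => ⟨by linarith [hx.1], hx.2⟩) hN0 hRdef hIic hnW
    rw [hν.measureReal_Iic_neg hB0] at hP
    refine ⟨_, MeasurableSet.iUnion fun j => measurableSet_oneBigJump
      (measurableSet_Ioc.prod measurableSet_Iic) (hW.prod hms) (hW.prod MeasurableSet.univ) _ j,
      (hfinal _ hW').trans hP, fun z hz => ?_⟩
    obtain ⟨j₀, hj₀⟩ := Set.mem_iUnion.1 hz
    exact lt_abs_changePointEstimator_sub_of_jump_right hs0 (by linarith) hd₀.1 hside hR0 hjump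
      hj₀
  · have hW' : l * s ≤ μX.real (Set.Ioc (d₀ - 2 * s) (d₀ - s)) := by
      refine le_trans (le_of_eq ?_) (le_measureReal_withDensity_Ioc (f := f) hl.le fun x hx =>
        (hf x (abs_le.2 ⟨by linarith [hx.1], by linarith [hx.2]⟩)).1)
      ring
    have hP := mul_half_measureReal_prod_le_iUnion_oneBigJump hγ hν μX (n := n) hW
      (measurableSet_Ioc (a := d₀ - 2 * s) (b := d₀ - s)) (measurableSet_Ici (a := B))
      (fun x hx => ⟨hx.1.le, by linarith [hx.2]⟩) hN0 hRdef hIci hnW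
    rw [hν.measureReal_Ici hB0] at hP
    refine ⟨_, MeasurableSet.iUnion fun j => measurableSet_oneBigJump
      (measurableSet_Ioc.prod measurableSet_Ici) (hW.prod hms) (hW.prod MeasurableSet.univ) _ j,
      (hfinal _ hW').trans hP, fun z hz => ?_⟩
    obtain ⟨j₀, hj₀⟩ := Set.mem_iUnion.1 hz
    exact lt_abs_changePointEstimator_sub_of_jump_left hs0 (by linarith) (by linarith) hd₀.2 hR0
      hjump hj₀

/-! ### The joint law of the design -/

theorem IsParallelDesign.isProbabilityMeasure_withDensity {Ω : Type*} [MeasurableSpace Ω]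
    {P : Measure Ω} [IsProbabilityMeasure P] {f : ℝ → ℝ} {ν : Measure ℝ} {m n : ℕ}
    {X ξ : Fin m → Fin n → Ω → ℝ} (h : IsParallelDesign P f ν X ξ) (hm : m ≠ 0) (hn : n ≠ 0) :
    IsProbabilityMeasure (volume.withDensity fun x => ENNReal.ofReal (f x)) := by
  rw [← h.law_X ⟨0, Nat.pos_of_ne_zero hm⟩ ⟨0, Nat.pos_of_ne_zero hn⟩]
  exact Measure.isProbabilityMeasure_map (h.measurable_X _ _).aemeasurable

theorem IsParallelDesign.map_eq_pi {Ω : Type*} [MeasurableSpace Ω] {P : Measure Ω}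
    [IsProbabilityMeasure P] {f : ℝ → ℝ} {ν : Measure ℝ} [IsProbabilityMeasure ν]
    [IsProbabilityMeasure (volume.withDensity fun x => ENNReal.ofReal (f x))]
    {m n : ℕ} {X ξ : Fin m → Fin n → Ω → ℝ} (h : IsParallelDesign P f ν X ξ) :
    P.map (fun ω i j => (X i j ω, ξ i j ω)) = Measure.pi fun _ : Fin m => Measure.pi
      fun _ : Fin n => (volume.withDensity fun x => ENNReal.ofReal (f x)).prod ν := by
  set μX := volume.withDensity fun x => ENNReal.ofReal (f x)
  have hX := h.measurable_X
  have hξ := h.measurable_ξ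
  have hm : ∀ i j, Measurable fun ω => (X i j ω, ξ i j ω) := fun i j => (hX i j).prodMk (hξ i j)
  have h1 : P.map (fun ω (p : Fin m × Fin n) => (X p.1 p.2 ω, ξ p.1 p.2 ω)) =
      Measure.infinitePi fun _ : Fin m × Fin n => μX.prod ν := by
    rw [h.indep.map_fun_eq_pi_map fun p : Fin m × Fin n => (hm p.1 p.2).aemeasurable, Measure.infinitePi_eq_pi]
    congr
    ext p : 1
    rw [(indepFun_iff_map_prod_eq_prod_map_map (hX _ _).aemeasurable (hξ _ _).aemeasurable).1
      (h.indep_X_ξ p.1 p.2), h.law_X, h.law_ξ]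
  have h2 := Measure.infinitePi_map_curry (fun (_ : Fin m) (_ : Fin n) => μX.prod ν)
  rw [← h1, Measure.map_map (MeasurableEquiv.measurable _)
    (measurable_pi_lambda _ fun p : Fin m × Fin n => hm p.1 p.2)] at h2
  simp_rw [Measure.infinitePi_eq_pi] at h2
  exact h2

theorem IsParallelDesign.map_row_eq_pi {Ω : Type*} [MeasurableSpace Ω] {P : Measure Ω}
    [IsProbabilityMeasure P] {f : ℝ → ℝ} {ν : Measure ℝ} [IsProbabilityMeasure ν]
    [IsProbabilityMeasure (volume.withDensity fun x => ENNReal.ofReal (f x))]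
    {m n : ℕ} {X ξ : Fin m → Fin n → Ω → ℝ} (h : IsParallelDesign P f ν X ξ) (i : Fin m) :
    P.map (fun ω j => (X i j ω, ξ i j ω)) = Measure.pi
      fun _ : Fin n => (volume.withDensity fun x => ENNReal.ofReal (f x)).prod ν := by
  have hm : Measurable fun ω i j => (X i j ω, ξ i j ω) :=
    measurable_pi_lambda _ fun i => measurable_pi_lambda _ fun j =>
      (h.measurable_X i j).prodMk (h.measurable_ξ i j)
  have h1 := (measurePreserving_eval (fun _ : Fin m => Measure.pi
    fun _ : Fin n => (volume.withDensity fun x => ENNReal.ofReal (f x)).prod ν) i).map_eq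
  rw [← h.map_eq_pi, Measure.map_map (measurable_pi_apply i) hm] at h1
  rw [← h1]
  rfl

/-! ### Least absolute deviations: a random walk with positive drift -/

/-- Hoeffding's inequality for steps in `[-1, 1]` with nonnegative mean. -/
theorem measureReal_pi_sum_nonpos_le {ν : Measure ℝ} [IsProbabilityMeasure ν] {h : ℝ → ℝ}
    (hh : Measurable h) (hb : ∀ x, |h x| ≤ 1) (hM : 0 ≤ ∫ x, h x ∂ν) {n : ℕ}
    (A : Finset (Fin n)) :
    (Measure.pi fun _ : Fin n => ν).real {ξ | ∑ j ∈ A, h (ξ j) ≤ 0} ≤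
      Real.exp (-((∫ x, h x ∂ν) ^ 2 / 2)) ^ A.card := by
  set M := ∫ x, h x ∂ν with hMdef
  rcases A.eq_empty_or_nonempty with rfl | hA
  · simp
  set Q := Measure.pi fun _ : Fin n => ν
  have hind : iIndepFun (fun (j : Fin n) (ξ : Fin n → ℝ) => M - h (ξ j)) Q :=
    iIndepFun_pi (X := fun _ e => M - h e) fun _ => (hh.const_sub M).aemeasurable
  have hi : Integrable h ν := Integrable.of_bound hh.aestronglyMeasurable 1
    (ae_of_all _ fun x => by simpa using hb x)
  have hsub : ∀ j ∈ A, HasSubgaussianMGF (fun ξ : Fin n → ℝ => M - h (ξ j)) 1 Q := by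
    intro j _
    have h1 : HasSubgaussianMGF (fun x => M - h x) 1 ν := by
      have := hasSubgaussianMGF_of_mem_Icc_of_integral_eq_zero (μ := ν) (X := fun x => M - h x)
        (a := M - 1) (b := M + 1) (hh.const_sub M).aemeasurable
        (ae_of_all _ fun x => ⟨by linarith [(abs_le.1 (hb x)).2],
          by linarith [(abs_le.1 (hb x)).1]⟩)
        (by rw [integral_sub (integrable_const _) hi]; simp [hMdef])
      convert this using 1
      rw [show M + 1 - (M - 1) = 2 by ring]
      ext
      simp
    rw [← (measurePreserving_eval (fun _ : Fin n => ν) j).map_eq] at h1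
    have h2 := h1.of_map (measurePreserving_eval (fun _ : Fin n => ν) j).measurable.aemeasurable
    exact h2
  have h2 := HasSubgaussianMGF.measure_sum_ge_le_of_iIndepFun hind hsub
    (ε := A.card * M) (by positivity)
  have hset : {ξ : Fin n → ℝ | ∑ j ∈ A, h (ξ j) ≤ 0} =
      {ξ | A.card * M ≤ ∑ j ∈ A, (M - h (ξ j))} := by
    ext ξ
    simp only [Set.mem_ofPred_eq, Finset.sum_sub_distrib, Finset.sum_const, nsmul_eq_mul]
    constructor <;> intro h <;> linarith
  rw [hset]
  refine h2.trans (le_of_eq ?_)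
  rw [← Real.exp_nat_mul]
  congr 1
  have : (A.card : ℝ) ≠ 0 := by exact_mod_cast hA.card_pos.ne'
  simp only [Finset.sum_const, nsmul_eq_mul, mul_one, NNReal.coe_natCast]
  field_simp

/-- A chain of finite sets has at most one member of each size, so geometric weights sum to at most
the geometric series started at the size of the smallest member. -/
theorem Finset.sum_pow_card_le_of_chain {α : Type*} [Fintype α] {C : Finset (Finset α)} {r : ℝ}
    (hr : 0 ≤ r) (hr1 : r < 1) (hC : ∀ A ∈ C, ∀ B ∈ C, A ⊆ B ∨ B ⊆ A) {N : ℕ}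
    (hN : ∀ A ∈ C, N ≤ A.card) : ∑ A ∈ C, r ^ A.card ≤ r ^ N / (1 - r) := by
  have hinj : Set.InjOn Finset.card (C : Set (Finset α)) := by
    intro A hA B hB hAB
    rcases hC A hA B hB with h | h
    · exact Finset.eq_of_subset_of_card_le h hAB.ge
    · exact (Finset.eq_of_subset_of_card_le h hAB.le).symm
  rw [← Finset.sum_image (f := fun k => r ^ k) hinj]
  refine (Finset.sum_le_sum_of_subset_of_nonneg (t := Finset.Ico N (Fintype.card α + 1)) ?_
    fun _ _ _ => by positivity).trans (geom_sum_Ico_le_of_lt_one hr hr1)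
  intro k hk
  obtain ⟨A, hA, rfl⟩ := Finset.mem_image.1 hk
  exact Finset.mem_Ico.2 ⟨hN A hA, Nat.lt_succ_of_le (Finset.card_le_univ A)⟩

theorem integral_pi_prod_ite_eq_pow {μX : Measure ℝ} [IsProbabilityMeasure μX] {W₀ : Set ℝ}
    [DecidablePred (· ∈ W₀)] (hW₀ : MeasurableSet W₀) (r : ℝ) (n : ℕ) :
    ∫ x, ∏ j, (if x j ∈ W₀ then r else 1) ∂(Measure.pi fun _ : Fin n => μX) =
      (1 - μX.real W₀ * (1 - r)) ^ n := by
  rw [integral_fintype_prod_eq_prod (fun (_ : Fin n) u => if u ∈ W₀ then r else 1)]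
  have : ∫ u, (if u ∈ W₀ then r else 1) ∂μX = 1 - μX.real W₀ * (1 - r) := by
    have h1 : (fun u => if u ∈ W₀ then r else 1) =
        fun u => 1 + W₀.indicator (fun _ => r - 1) u := by
      ext u
      by_cases hu : u ∈ W₀ <;> simp [hu]
    rw [h1, integral_add (integrable_const _) ((integrable_const _).indicator hW₀),
      integral_indicator_const _ hW₀]
    simp
    ring
  simp [this]

/-- For a countable chain of windows `W q` around `W₀`, the probability that the errors of the
observations in some window have a nonpositive sum. Given the covariates, the windows select a
chain of index sets, over which the union bound costs a geometric series. -/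
theorem measure_prod_exists_sum_nonpos_le {ι : Type*} [Countable ι] {μX ν : Measure ℝ}
    [IsProbabilityMeasure μX] [IsProbabilityMeasure ν] {h : ℝ → ℝ} (hh : Measurable h)
    {W : ι → Set ℝ} [∀ q, DecidablePred (· ∈ W q)] (hW : ∀ q, MeasurableSet (W q))
    (hchain : ∀ q q', W q ⊆ W q' ∨ W q' ⊆ W q)
    {W₀ : Set ℝ} (hW₀ : MeasurableSet W₀) (hsub : ∀ q, W₀ ⊆ W q) {r : ℝ} (hr : 0 ≤ r)
    (hr1 : r < 1) {n : ℕ} (hA : ∀ A : Finset (Fin n),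
      (Measure.pi fun _ : Fin n => ν).real {ξ | ∑ j ∈ A, h (ξ j) ≤ 0} ≤ r ^ A.card) :
    ((Measure.pi fun _ : Fin n => μX).prod (Measure.pi fun _ : Fin n => ν)).real
      {p | ∃ q, ∑ j with p.1 j ∈ W q, h (p.2 j) ≤ 0} ≤
      (1 - μX.real W₀ * (1 - r)) ^ n / (1 - r) := by
  classical
  set QX := Measure.pi fun _ : Fin n => μX
  set Qξ := Measure.pi fun _ : Fin n => ν
  have hmeas : MeasurableSet {p : (Fin n → ℝ) × (Fin n → ℝ) |
      ∃ q, ∑ j with p.1 j ∈ W q, h (p.2 j) ≤ 0} := by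
    have : {p : (Fin n → ℝ) × (Fin n → ℝ) | ∃ q, ∑ j with p.1 j ∈ W q, h (p.2 j) ≤ 0} =
        ⋃ q, {p | ∑ j, (if p.1 j ∈ W q then h (p.2 j) else 0) ≤ 0} := by
      ext p
      simp [Finset.sum_filter]
    rw [this]
    refine MeasurableSet.iUnion fun q => measurableSet_le ?_ measurable_const
    refine Finset.measurable_sum _ fun j _ => Measurable.ite ?_ ?_ measurable_const
    · exact (measurable_pi_apply j).comp measurable_fst (hW q)
    · exact hh.comp ((measurable_pi_apply j).comp measurable_snd)
  have hfiber : ∀ x : Fin n → ℝ, Qξ.real {ξ | ∃ q, ∑ j with x j ∈ W q, h (ξ j) ≤ 0} ≤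
      (∏ j, if x j ∈ W₀ then r else 1) / (1 - r) := by
    intro x
    set C : Finset (Finset (Fin n)) :=
      Finset.univ.filter fun A => ∃ q, A = Finset.univ.filter fun j => x j ∈ W q with hC
    have h1 : {ξ : Fin n → ℝ | ∃ q, ∑ j with x j ∈ W q, h (ξ j) ≤ 0} ⊆
        ⋃ A ∈ C, {ξ | ∑ j ∈ A, h (ξ j) ≤ 0} := by
      rintro ξ ⟨q, hq⟩
      refine Set.mem_biUnion (x := Finset.univ.filter fun j => x j ∈ W q) ?_ hq
      exact Finset.mem_coe.2 (Finset.mem_filter.2 ⟨Finset.mem_univ _, q, rfl⟩)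
    calc Qξ.real {ξ | ∃ q, ∑ j with x j ∈ W q, h (ξ j) ≤ 0}
        ≤ ∑ A ∈ C, Qξ.real {ξ | ∑ j ∈ A, h (ξ j) ≤ 0} :=
          (measureReal_mono h1 (measure_ne_top _ _)).trans (measureReal_biUnion_finset_le _ _)
      _ ≤ ∑ A ∈ C, r ^ A.card := Finset.sum_le_sum fun A _ => hA A
      _ ≤ r ^ (Finset.univ.filter fun j => x j ∈ W₀).card / (1 - r) := by
          refine Finset.sum_pow_card_le_of_chain hr hr1 ?_ ?_
          · intro A hA B hB
            obtain ⟨q, rfl⟩ := (Finset.mem_filter.1 hA).2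
            obtain ⟨q', rfl⟩ := (Finset.mem_filter.1 hB).2
            rcases hchain q q' with hq | hq
            · exact .inl (Finset.monotone_filter_right _ fun j _ hj => hq hj)
            · exact .inr (Finset.monotone_filter_right _ fun j _ hj => hq hj)
          · intro A hA
            obtain ⟨q, rfl⟩ := (Finset.mem_filter.1 hA).2
            exact Finset.card_le_card (Finset.monotone_filter_right _ fun j _ hj => hsub q hj)
      _ = _ := by rw [Finset.prod_ite]; simp
  have hg : Integrable (fun x : Fin n → ℝ => (∏ j, if x j ∈ W₀ then r else 1) / (1 - r)) QX := by
    refine Integrable.div_const ?_ _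
    refine Integrable.of_bound (C := 1) ?_ (ae_of_all _ fun x => ?_)
    · refine (Finset.measurable_prod _ fun j _ => ?_).aestronglyMeasurable
      exact Measurable.ite (measurable_pi_apply j hW₀) measurable_const measurable_const
    · rw [Real.norm_eq_abs, Finset.abs_prod]
      refine Finset.prod_le_one (fun _ _ => abs_nonneg _) fun j _ => ?_
      split_ifs
      · rw [abs_of_nonneg hr]; exact hr1.le
      · simp
  have hg0 : ∀ x : Fin n → ℝ, 0 ≤ (∏ j, if x j ∈ W₀ then r else 1) / (1 - r) := fun x =>
    measureReal_nonneg.trans (hfiber x)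
  rw [← integral_pi_prod_ite_eq_pow hW₀, ← integral_div, measureReal_def]
  refine ENNReal.toReal_le_of_le_ofReal (integral_nonneg hg0) ?_
  rw [Measure.prod_apply hmeas, ofReal_integral_eq_lintegral_ofReal hg (ae_of_all _ hg0)]
  refine lintegral_mono fun x => ?_
  rw [← ENNReal.ofReal_toReal (measure_ne_top Qξ _)]
  exact ENNReal.ofReal_le_ofReal (hfiber x)

/-- If the least absolute deviations estimator overshoots, the walk with steps `|ξ + 1| - |ξ|` over
the observations between `d₀` and the estimator is nonpositive. -/
theorem exists_rat_sum_nonpos_of_lt_estimator {a b d₀ s : ℝ} (hs : 0 < s) (hab : a ≤ b)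
    (hd₀ : d₀ ∈ Set.Icc a b) {n : ℕ} (hn : n ≠ 0) {x ξ : Fin n → ℝ}
    (h : d₀ + s < changePointEstimator (fun u => |u|) a b x
      (fun j => (if d₀ < x j then 1 else 0) + ξ j)) :
    ∃ q : {q : ℚ // d₀ + s < q}, ∑ j with x j ∈ Set.Ioc d₀ (q : ℚ), (|ξ j + 1| - |ξ j|) ≤ 0 := by
  set y : Fin n → ℝ := fun j => (if d₀ < x j then 1 else 0) + ξ j with hy
  set e := changePointEstimator (fun u => |u|) a b x y
  have hmin : stumpCriterion (fun u => |u|) x y e ≤ stumpCriterion (fun u => |u|) x y d₀ :=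
    (changePointEstimator_isLeast (fun u => |u|) hab x y).1.2 _ hd₀
  have hsum := stumpCriterion_sub (φ := fun u => |u|) hn x y (show d₀ ≤ e by linarith)
  have h0 := mul_nonpos_of_nonneg_of_nonpos (Nat.cast_nonneg (α := ℝ) n) (sub_nonpos.2 hmin)
  rw [hsum] at h0
  obtain ⟨q, hq1, -, hq⟩ := exists_rat_gt_forall_le_iff x (lt_add_one e)
  refine ⟨⟨q, h.trans hq1⟩, le_trans (le_of_eq ?_) h0⟩
  refine Finset.sum_congr ?_ fun j hj => ?_
  · ext j
    simp [hq j]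
  · have h1 : d₀ < x j := (Finset.mem_filter.1 hj).2.1
    simp only [hy, if_pos h1]
    rw [add_sub_cancel_left, add_comm]

/-- If the least absolute deviations estimator undershoots, the walk with steps `|-ξ + 1| - |-ξ|`
over the observations between the estimator and `d₀` is nonpositive. -/
theorem exists_rat_sum_nonpos_of_estimator_lt {a b d₀ s : ℝ} (hs : 0 < s) (hab : a ≤ b)
    (hd₀ : d₀ ∈ Set.Icc a b) {n : ℕ} (hn : n ≠ 0) {x ξ : Fin n → ℝ}
    (h : changePointEstimator (fun u => |u|) a b x
      (fun j => (if d₀ < x j then 1 else 0) + ξ j) < d₀ - s) :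
    ∃ q : {q : ℚ // (q : ℝ) < d₀ - s},
      ∑ j with x j ∈ Set.Ioc ((q : ℚ) : ℝ) d₀, (|-ξ j + 1| - |-ξ j|) ≤ 0 := by
  set y : Fin n → ℝ := fun j => (if d₀ < x j then 1 else 0) + ξ j with hy
  set e := changePointEstimator (fun u => |u|) a b x y
  have hmin : stumpCriterion (fun u => |u|) x y e ≤ stumpCriterion (fun u => |u|) x y d₀ :=
    (changePointEstimator_isLeast (fun u => |u|) hab x y).1.2 _ hd₀
  have hsum := stumpCriterion_sub (φ := fun u => |u|) hn x y (show e ≤ d₀ by linarith)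
  have h0 := mul_nonneg (Nat.cast_nonneg (α := ℝ) n) (sub_nonneg.2 hmin)
  rw [hsum, ← neg_nonpos, ← Finset.sum_neg_distrib] at h0
  obtain ⟨q, -, hq2, hq⟩ := exists_rat_gt_forall_le_iff x h
  refine ⟨⟨q, hq2⟩, le_trans (le_of_eq ?_) h0⟩
  refine Finset.sum_congr ?_ fun j hj => ?_
  · ext j
    have := not_congr (hq j)
    simp only [not_le] at this
    simp [this]
  · have h1 : x j ≤ d₀ := (Finset.mem_filter.1 hj).2.2
    simp only [hy, if_neg (not_lt.2 h1)]
    rw [zero_add, abs_neg, neg_sub, ← abs_neg (ξ j - 1), neg_sub, neg_add_eq_sub]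

/-- The one-problem tail bound for least absolute deviations, with the full Hoeffding rate
`exp (-μ² / 2)`. -/
theorem IsParallelDesign.measureReal_lt_changePointError_abs_le {γ : ℝ} {ν : Measure ℝ}
    [IsProbabilityMeasure ν] (hν : IsSymmPowerTail γ ν) {f : ℝ → ℝ}
    [IsProbabilityMeasure (volume.withDensity fun x => ENNReal.ofReal (f x))]
    {Ω : Type*} [MeasurableSpace Ω] {P : Measure Ω} [IsProbabilityMeasure P] {m n : ℕ}
    {X ξ : Fin m → Fin n → Ω → ℝ} (h : IsParallelDesign P f ν X ξ) {a b : ℝ} (hab : a ≤ b)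
    (hn : n ≠ 0) {d₀ : Fin m → ℝ} (i : Fin m) (hd₀ : d₀ i ∈ Set.Icc a b) {s l : ℝ} (hs : 0 < s)
    (hl : 0 ≤ l) (hf : ∀ x, |x - d₀ i| ≤ s → l ≤ f x) :
    P.real {ω | s < changePointError (fun u => |u|) a b d₀ X ξ i ω} ≤
      2 * (Real.exp (-(n * (l * s) * (1 - Real.exp (-(absStepMean ν ^ 2 / 2))))) /
        (1 - Real.exp (-(absStepMean ν ^ 2 / 2)))) := by
  classical
  set μX := volume.withDensity fun x => ENNReal.ofReal (f x)
  set r := Real.exp (-(absStepMean ν ^ 2 / 2)) with hr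
  have hM := hν.absStepMean_pos
  have hr0 : 0 ≤ r := (Real.exp_pos _).le
  have hr1 : r < 1 := Real.exp_lt_one_iff.2 (neg_lt_zero.2 (by positivity))
  set QX := Measure.pi fun _ : Fin n => μX
  set Qξ := Measure.pi fun _ : Fin n => ν
  have hX := h.measurable_X i
  have hξ := h.measurable_ξ i
  have hpair : Measurable fun ω j => (X i j ω, ξ i j ω) :=
    measurable_pi_lambda _ fun j => (hX j).prodMk (hξ j)
  have hΦ : Measurable fun ω => ((fun j => X i j ω), fun j => ξ i j ω) :=
    (measurable_pi_lambda _ hX).prodMk (measurable_pi_lambda _ hξ)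
  have hlaw : P.map (fun ω => ((fun j => X i j ω), fun j => ξ i j ω)) = QX.prod Qξ := by
    rw [← (measurePreserving_arrowProdEquivProdArrow ℝ ℝ (Fin n) (fun _ => μX)
      (fun _ => ν)).map_eq, ← h.map_row_eq_pi i, Measure.map_map (MeasurableEquiv.measurable _)
        hpair]
    rfl
  have hle : ∀ E : Set ((Fin n → ℝ) × (Fin n → ℝ)),
      P.real {ω | ((fun j => X i j ω), fun j => ξ i j ω) ∈ E} ≤ (QX.prod Qξ).real E := fun E => by
    rw [← hlaw]
    have : IsProbabilityMeasure
        (P.map (fun ω => ((fun j => X i j ω), fun j => ξ i j ω))) :=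
      Measure.isProbabilityMeasure_map hΦ.aemeasurable
    exact ENNReal.toReal_mono (measure_ne_top _ _) (Measure.le_map_apply hΦ.aemeasurable E)
  have hpow : ∀ W₀ : Set ℝ, l * s ≤ μX.real W₀ →
      (1 - μX.real W₀ * (1 - r)) ^ n / (1 - r) ≤
        Real.exp (-(n * (l * s) * (1 - r))) / (1 - r) := by
    intro W₀ hW₀
    have h1r : 0 < 1 - r := sub_pos.2 hr1
    have h0 : 0 ≤ 1 - μX.real W₀ * (1 - r) :=
      sub_nonneg.2 (mul_le_one₀ measureReal_le_one h1r.le (by linarith))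
    have h1 : 1 - μX.real W₀ * (1 - r) ≤ Real.exp (-(l * s * (1 - r))) := by
      have h2 := Real.add_one_le_exp (-(l * s * (1 - r)))
      have h3 := mul_le_mul_of_nonneg_right hW₀ h1r.le
      linarith
    rw [show -(n * (l * s) * (1 - r)) = n * -(l * s * (1 - r)) by ring, Real.exp_nat_mul]
    gcongr
  have hg : ∀ x : ℝ, |(|-x + 1| - |-x|)| ≤ 1 := fun x => abs_abs_add_one_sub_abs_le (-x)
  have hright := (measure_prod_exists_sum_nonpos_le (μX := μX) (ν := ν) (n := n)
    (ι := {q : ℚ // d₀ i + s < q}) (h := fun x => |x + 1| - |x|) (by fun_prop)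
    (W := fun q => Set.Ioc (d₀ i) (q : ℚ)) (fun q => measurableSet_Ioc)
    (fun q q' => (le_total (q : ℚ) q').imp
      (fun hqq => Set.Ioc_subset_Ioc_right (by exact_mod_cast hqq))
      fun hqq => Set.Ioc_subset_Ioc_right (by exact_mod_cast hqq))
    (measurableSet_Ioc (a := d₀ i) (b := d₀ i + s))
    (fun q => Set.Ioc_subset_Ioc_right q.2.le) hr0 hr1
    fun A => measureReal_pi_sum_nonpos_le (by fun_prop) abs_abs_add_one_sub_abs_le hM.le A).trans
    (hpow _ (le_trans (le_of_eq (by ring)) (le_measureReal_withDensity_Ioc (f := f) hl fun x hx =>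
      hf x (abs_le.2 ⟨by linarith [hx.1], by linarith [hx.2]⟩))))
  have hleft := (measure_prod_exists_sum_nonpos_le (μX := μX) (ν := ν) (n := n)
    (ι := {q : ℚ // (q : ℝ) < d₀ i - s}) (h := fun x => |-x + 1| - |-x|) (by fun_prop)
    (W := fun q => Set.Ioc ((q : ℚ) : ℝ) (d₀ i)) (fun q => measurableSet_Ioc)
    (fun q q' => (le_total (q' : ℚ) q).imp
      (fun hqq => Set.Ioc_subset_Ioc_left (by exact_mod_cast hqq))
      fun hqq => Set.Ioc_subset_Ioc_left (by exact_mod_cast hqq))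
    (measurableSet_Ioc (a := d₀ i - s) (b := d₀ i))
    (fun q => Set.Ioc_subset_Ioc_left q.2.le) hr0 hr1
    fun A => by
      rw [hr, hν.absStepMean_eq_integral_neg]
      exact measureReal_pi_sum_nonpos_le (by fun_prop) hg
        (hν.absStepMean_eq_integral_neg ▸ hM.le) A).trans
    (hpow _ (le_trans (le_of_eq (by ring)) (le_measureReal_withDensity_Ioc (f := f) hl fun x hx =>
      hf x (abs_le.2 ⟨by linarith [hx.1], by linarith [hx.2]⟩))))
  rw [two_mul]
  refine le_trans ?_ (add_le_add ((hle _).trans hright) ((hle _).trans hleft))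
  refine (measureReal_mono fun ω hω => ?_).trans (measureReal_union_le _ _)
  rcases lt_abs.1 (show s < |_| from hω) with h1 | h1
  · exact .inl (exists_rat_sum_nonpos_of_lt_estimator hs hab hd₀ hn
      (by simp only [stumpResponse] at h1; linarith))
  · exact .inr (exists_rat_sum_nonpos_of_estimator_lt hs hab hd₀ hn
      (by simp only [stumpResponse] at h1; linarith))

/-- The walk may be empty on the left of the change point, which costs `1 / (1 - exp (-8 c))`
rather than `exp (-c) / (1 - exp (-c))`; the slack in the rate pays for it. -/
theorem inv_one_sub_exp_neg_eight_mul_le {c : ℝ} (hc : 0 < c) (hc1 : c ≤ 1 / 16) :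
    1 / (1 - Real.exp (-(8 * c))) ≤ Real.exp (-c) / (1 - Real.exp (-c)) := by
  set y := Real.exp (-c) with hy
  have hy1 : y < 1 := Real.exp_lt_one_iff.2 (by linarith)
  have hy0 : 15 / 16 ≤ y := by linarith [Real.add_one_le_exp (-c)]
  have h8 : Real.exp (-(8 * c)) ≤ y ^ 2 := by
    rw [hy, ← Real.exp_nat_mul]
    exact Real.exp_le_exp.2 (by push_cast; linarith)
  rw [div_le_div_iff₀ (by nlinarith) (by linarith)]
  have h2 : y * (1 - y ^ 2) ≤ y * (1 - Real.exp (-(8 * c))) := by gcongr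
  nlinarith [mul_nonneg (sub_nonneg.2 hy1.le) (show 0 ≤ y * (1 + y) - 1 by nlinarith)]

/-! ### The two rates -/

/-- The lower bound for least squares at a fixed sample size, once the critical scale
`t * m ^ (1 / γ) / n` is small. -/
theorem IsParallelDesign.le_measureReal_iSup_changePointError_sq {γ : ℝ} (hγ : 0 < γ)
    {ν : Measure ℝ} [IsProbabilityMeasure ν] (hν : IsSymmPowerTail γ ν) {f : ℝ → ℝ}
    {Ω : Type*} [MeasurableSpace Ω] {P : Measure Ω} [IsProbabilityMeasure P] {m n : ℕ}
    (hm : m ≠ 0) (hn : n ≠ 0) {X ξ : Fin m → Fin n → Ω → ℝ} (h : IsParallelDesign P f ν X ξ)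
    {a b : ℝ} {d₀ : Fin m → ℝ} (hd₀ : ∀ i, d₀ i ∈ Set.Icc a b) {l u s t : ℝ}
    (hl : 0 < l) (hu : 0 < u) (ht : 0 < t) (hs : s = t * (m : ℝ) ^ (1 / γ) / n)
    (hsab : 4 * s ≤ b - a) (hf : ∀ i, ∀ x, |x - d₀ i| ≤ 2 * s → l ≤ f x ∧ f x ≤ u) :
    1 - Real.exp (-jumpRate γ l u t) ≤ P.real {ω | t < ⨆ i, (n : ℝ) / (m : ℝ) ^ (1 / γ) *
      changePointError (fun v => v ^ 2) a b d₀ X ξ i ω} := by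
  have := h.isProbabilityMeasure_withDensity hm hn
  choose F hFm hFp hF using fun i =>
    exists_large_least_squares_error hγ hν hm hn (hd₀ i) hl hu ht hs hsab (hf i)
  refine (one_sub_exp_neg_le_measureReal_pi_exists hm _ hFm hFp).trans ?_
  have hΨ : Measurable fun ω i j => (X i j ω, ξ i j ω) :=
    measurable_pi_lambda _ fun i => measurable_pi_lambda _ fun j =>
      (h.measurable_X i j).prodMk (h.measurable_ξ i j)
  have hmeas : MeasurableSet {z : Fin m → Fin n → ℝ × ℝ | ∃ i, z i ∈ F i} := by
    rw [Set.ofPred_exists]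
    exact MeasurableSet.iUnion fun i => measurable_pi_apply i (hFm i)
  rw [← h.map_eq_pi, map_measureReal_apply hΨ hmeas]
  refine measureReal_mono fun ω hω => ?_
  obtain ⟨i, hi⟩ : ∃ i, (fun j => (X i j ω, ξ i j ω)) ∈ F i := hω
  have h1 : s < changePointError (fun v => v ^ 2) a b d₀ X ξ i ω := hF i (fun j => (X i j ω, ξ i j ω)) hi
  have hm0 : (0 : ℝ) < m := by exact_mod_cast Nat.pos_of_ne_zero hm
  have hn0 : (0 : ℝ) < n := by exact_mod_cast Nat.pos_of_ne_zero hn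
  have hratio : 0 < (n : ℝ) / (m : ℝ) ^ (1 / γ) := by positivity
  have h2 := mul_lt_mul_of_pos_left h1 hratio
  have h3 : (n : ℝ) / (m : ℝ) ^ (1 / γ) * s = t := by
    rw [hs]; field_simp
  rw [h3] at h2
  exact h2.trans_le (le_ciSup (f := fun i => (n : ℝ) / (m : ℝ) ^ (1 / γ) *
    changePointError (fun v => v ^ 2) a b d₀ X ξ i ω) (Set.finite_range _).bddAbove i)

/-- The upper bound for least absolute deviations at a fixed sample size, once the critical scale
`t * log m / n` is small. -/
theorem IsParallelDesign.measureReal_iSup_changePointError_abs_le {γ : ℝ}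
    {ν : Measure ℝ} [IsProbabilityMeasure ν] (hν : IsSymmPowerTail γ ν) {f : ℝ → ℝ}
    {Ω : Type*} [MeasurableSpace Ω] {P : Measure Ω} [IsProbabilityMeasure P] {m n : ℕ}
    (hm : 1 < m) (hn : n ≠ 0) {X ξ : Fin m → Fin n → Ω → ℝ} (h : IsParallelDesign P f ν X ξ)
    {a b : ℝ} (hab : a ≤ b) {d₀ : Fin m → ℝ} (hd₀ : ∀ i, d₀ i ∈ Set.Icc a b)
    (hf0 : ∀ i, 0 ≤ f (d₀ i)) {s t : ℝ} (ht : 0 < t) (hs : s = t * Real.log m / n)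
    (hf : ∀ i, ∀ x, |x - d₀ i| ≤ s → f (d₀ i) / 2 ≤ f x) :
    P.real {ω | t < (n : ℝ) / Real.log m *
        ⨆ i, changePointError (fun u => |u|) a b d₀ X ξ i ω} ≤
      2 * Real.exp (-absStepRate ν) / (1 - Real.exp (-absStepRate ν)) *
        Real.exp (-(Real.log m *
          (t * ((⨅ i, f (d₀ i)) / 2) * (1 - Real.exp (-absStepRate ν)) - 1))) := by
  have := h.isProbabilityMeasure_withDensity (by omega) hn
  have : Nonempty (Fin m) := ⟨⟨0, by omega⟩⟩
  have hm0 : (0 : ℝ) < m := by exact_mod_cast (by omega : 0 < m)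
  have hn0 : (0 : ℝ) < n := by exact_mod_cast Nat.pos_of_ne_zero hn
  have hlog : 0 < Real.log m := Real.log_pos (by exact_mod_cast hm)
  have hs0 : 0 < s := by rw [hs]; positivity
  set c := absStepRate ν with hc
  set fmin := ⨅ i, f (d₀ i) with hfmin
  have hfmin0 : 0 ≤ fmin := le_ciInf hf0
  have hM := hν.absStepMean_pos
  have hM1 := absStepMean_le_one ν
  have hceq : c = absStepMean ν ^ 2 / 16 := hν.absStepRate_eq
  have hc0 : 0 < c := by rw [hceq]; positivity
  have hc1 : c ≤ 1 / 16 := by rw [hceq]; nlinarith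
  have h8c : absStepMean ν ^ 2 / 2 = 8 * c := by rw [hceq]; ring
  have hrow : ∀ i, P.real {ω | s < changePointError (fun u => |u|) a b d₀ X ξ i ω} ≤
      2 * (Real.exp (-c) / (1 - Real.exp (-c)) *
        Real.exp (-(Real.log m * (t * (fmin / 2) * (1 - Real.exp (-c)))))) := by
    intro i
    have hfi : fmin ≤ f (d₀ i) := ciInf_le (Set.finite_range _).bddBelow i
    refine (h.measureReal_lt_changePointError_abs_le hν hab hn i (hd₀ i) hs0
      (l := fmin / 2) (by positivity) fun x hx => le_trans (by linarith) (hf i x hx)).trans ?_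
    rw [h8c, div_eq_mul_one_div, mul_comm (Real.exp _) (1 / _)]
    have he : Real.exp (-(8 * c)) ≤ Real.exp (-c) := Real.exp_le_exp.2 (by linarith)
    have hns : n * (fmin / 2 * s) = Real.log m * (t * (fmin / 2)) := by
      rw [hs]; field_simp
    refine mul_le_mul_of_nonneg_left (mul_le_mul (inv_one_sub_exp_neg_eight_mul_le hc0 hc1)
      (Real.exp_le_exp.2 (neg_le_neg ?_)) (Real.exp_pos _).le ?_) zero_le_two
    · rw [hns, ← mul_assoc]
      gcongr
    · exact div_nonneg (Real.exp_pos _).le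
        (sub_nonneg.2 (Real.exp_le_one_iff.2 (by linarith)))
  have hsub : {ω | t < (n : ℝ) / Real.log m *
      ⨆ i, changePointError (fun u => |u|) a b d₀ X ξ i ω} ⊆
      ⋃ i ∈ (Finset.univ : Finset (Fin m)),
        {ω | s < changePointError (fun u => |u|) a b d₀ X ξ i ω} := by
    intro ω hω
    by_contra hcon
    simp only [Finset.mem_univ, Set.iUnion_true, Set.mem_iUnion, Set.mem_ofPred_eq, not_exists,
      not_lt] at hcon
    have h1 : (n : ℝ) / Real.log m * ⨆ i, changePointError (fun u => |u|) a b d₀ X ξ i ω ≤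
        (n : ℝ) / Real.log m * s := mul_le_mul_of_nonneg_left (ciSup_le hcon) (by positivity)
    have h2 : (n : ℝ) / Real.log m * s = t := by rw [hs]; field_simp
    rw [h2] at h1
    exact not_lt.2 h1 hω
  calc P.real {ω | t < (n : ℝ) / Real.log m *
        ⨆ i, changePointError (fun u => |u|) a b d₀ X ξ i ω}
      ≤ ∑ i : Fin m, P.real {ω | s < changePointError (fun u => |u|) a b d₀ X ξ i ω} :=
        (measureReal_mono hsub (measure_ne_top _ _)).trans (measureReal_biUnion_finset_le _ _)
    _ ≤ ∑ _i : Fin m, 2 * (Real.exp (-c) / (1 - Real.exp (-c)) *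
        Real.exp (-(Real.log m * (t * (fmin / 2) * (1 - Real.exp (-c)))))) :=
        Finset.sum_le_sum fun i _ => hrow i
    _ = 2 * Real.exp (-c) / (1 - Real.exp (-c)) * (m *
        Real.exp (-(Real.log m * (t * (fmin / 2) * (1 - Real.exp (-c)))))) := by
        rw [Finset.sum_const, Finset.card_univ, Fintype.card_fin, nsmul_eq_mul]
        ring
    _ = _ := by
        rw [show -(Real.log m * (t * (fmin / 2) * (1 - Real.exp (-c)) - 1)) =
          Real.log m + -(Real.log m * (t * (fmin / 2) * (1 - Real.exp (-c)))) by ring,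
          Real.exp_add, Real.exp_log hm0]

theorem theorem3p1
    (γ : ℝ) (hγ : 0 < γ)
    (ν : Measure ℝ) [IsProbabilityMeasure ν] (hν : IsSymmPowerTail γ ν)
    (f : ℝ → ℝ) (hf_meas : Measurable f) (hf_nonneg : ∀ x, 0 ≤ f x)
    (a b : ℝ) (hab : a < b)
    (K : Set ℝ) (hK : IsCompact K) (hKI : K ⊆ Set.Icc a b)
    (hf_cont : ∀ d ∈ K, ContinuousAt f d) (hf_pos : ∀ d ∈ K, 0 < f d) :
    ∃ c : ℝ → ℝ, (∀ t, 0 < t → 0 < c t) ∧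
      ∀ (m : ℕ → ℕ) (Ω : ℕ → Type*) [∀ n, MeasurableSpace (Ω n)]
        (P : ∀ n, Measure (Ω n)) [∀ n, IsProbabilityMeasure (P n)]
        (d₀ : ∀ n, Fin (m n) → ℝ) (X ξ : ∀ n, Fin (m n) → Fin n → Ω n → ℝ),
        (∀ n i, d₀ n i ∈ K) →
        (∀ n, IsParallelDesign (P n) f ν (X n) (ξ n)) →
        -- least squares
        (Tendsto (fun n : ℕ => (n : ℝ) / (m n : ℝ) ^ (1 / γ)) atTop atTop →
          ∀ t : ℝ, 0 < t →
            c t ≤ liminf (fun n : ℕ => (P n).real {ω | t <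
              ⨆ i, (n : ℝ) / (m n : ℝ) ^ (1 / γ) *
                changePointError (fun u => u ^ 2) a b (d₀ n) (X n) (ξ n) i ω}) atTop) ∧
        -- least absolute deviations
        (Tendsto (fun n : ℕ => (n : ℝ) / Real.log (m n)) atTop atTop →
          ∀ t : ℝ, 0 < t → ∀ᶠ n : ℕ in atTop,
            (P n).real {ω | t <
              (n : ℝ) / Real.log (m n) *
                ⨆ i, changePointError (fun u => |u|) a b (d₀ n) (X n) (ξ n) i ω} ≤
              2 * Real.exp (-absStepRate ν) / (1 - Real.exp (-absStepRate ν)) *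
                Real.exp (-(Real.log (m n) *
                  (t * ((⨅ i, f (d₀ n i)) / 2) * (1 - Real.exp (-absStepRate ν)) - 1)))) := by

  obtain ⟨δ, hδ, l, hl, u, hu, hlu⟩ := hK.exists_pos_bounds hf_cont hf_pos
  obtain ⟨δ', hδ', hhalf⟩ := hK.exists_half_le_le_two_mul hf_cont hf_pos
  refine ⟨fun t => 1 - Real.exp (-jumpRate γ l u t), fun t ht => sub_pos.2
    (Real.exp_lt_one_iff.2 (neg_lt_zero.2 (jumpRate_pos hl hu ht))), ?_⟩
  intro m Ω _ P _ d₀ X ξ hd₀ hdesign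
  refine ⟨fun hlim t ht => ?_, fun hlim t ht => ?_⟩
  · refine le_liminf_of_le
      (isCoboundedUnder_ge_of_le (x := 1) atTop fun _ => measureReal_le_one) ?_
    filter_upwards [hlim.eventually_gt_atTop 0, hlim.eventually_ge_atTop (2 * t / δ),
      hlim.eventually_ge_atTop (4 * t / (b - a))] with n h0 h1 h2
    have hn : n ≠ 0 := by
      rintro rfl
      simp at h0
    -- In Lean `0 ^ (1 / γ) = 0` and `n / 0 = 0`, so a positive ratio excludes `m n = 0`.
    have hm : m n ≠ 0 := by
      intro hm
      rw [hm, Nat.cast_zero, Real.zero_rpow (by positivity), div_zero] at h0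
      exact lt_irrefl _ h0
    have hs : t * (m n : ℝ) ^ (1 / γ) / n = t / ((n : ℝ) / (m n : ℝ) ^ (1 / γ)) := by
      rw [div_div_eq_mul_div]
    have hba : 0 < b - a := sub_pos.2 hab
    refine (hdesign n).le_measureReal_iSup_changePointError_sq hγ hν hm hn
      (fun i => hKI (hd₀ n i)) hl hu ht rfl ?_ fun i x hx => hlu _ (hd₀ n i) x (hx.trans ?_)
    · rw [hs, ← mul_div_assoc, div_le_iff₀ h0]
      rw [div_le_iff₀ hba] at h2
      linarith
    · rw [hs, ← mul_div_assoc, div_le_iff₀ h0]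
      rw [div_le_iff₀ hδ] at h1
      linarith
  · filter_upwards [hlim.eventually_gt_atTop 0, hlim.eventually_ge_atTop (t / δ')] with n h0 h1
    have hn : n ≠ 0 := by
      rintro rfl
      simp at h0
    -- Likewise `log 0 = log 1 = 0` and `n / 0 = 0`, so a positive ratio forces `m n ≥ 2`.
    have hm : 1 < m n := by
      by_contra! hm
      interval_cases m n <;> simp at h0
    have hs : t * Real.log (m n) / n = t / ((n : ℝ) / Real.log (m n)) := by
      rw [div_div_eq_mul_div]
    refine (hdesign n).measureReal_iSup_changePointError_abs_le hν hm hn hab.le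
      (fun i => hKI (hd₀ n i)) (fun i => (hf_pos _ (hd₀ n i)).le) ht rfl
      fun i x hx => (hhalf _ (hd₀ n i) x (hx.trans ?_)).1
    rw [hs, div_le_iff₀ h0]
    rw [div_le_iff₀ hδ'] at h1
    linarith
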